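/- Let $\mathcal H,\mathcal K,\mathcal H_E$ be finite-dimensional complex Hilbert spaces, let $U:\mathcal H\to\mathcal K\otimes\mathcal H_E$ be an isometry, and let $\mathcal T:\mathcal B(\mathcal H)\to\mathcal B(\mathcal K)$, $\mathcal T(X)=\operatorname{tr}_E[UXU^*]$, be the corresponding quantum channel. Let $\mathcal T^*$ be its adjoint with respect to the Hilbert–Schmidt inner products. Let $\rho,\sigma$ be states (positive semidefinite operators of trace one) on $\mathcal H$ with $\operatorname{supp}\rho\le\operatorname{supp}\sigma$. Negative powers and logarithms of positive semidefinite operators are taken on their supports and extended by zero. Write $$\widehat D(\rho\|\sigma)=\begin{cases}\operatorname{tr}[\rho\log(\rho^{1/2}\sigma^{-1}\rho^{1/2})] & \text{if }\ker\sigma\subseteq\ker\rho,\\ +\infty&\text{otherwise,}\end{cases}$$ for the Belavkin–Staszewski entropy, $[\rho/\sigma]=\sigma^{-1/2}\rho\,\sigma^{-1/2}$, and $$\mathcal T_\sigma(X)=\mathcal T(\sigma)^{-1/2}\,\mathcal T(\sigma^{1/2}X\sigma^{1/2})\,\mathcal T(\sigma)^{-1/2}$$ for the adjoint of the Petz recovery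 map $Y\mapsto\sigma^{1/2}\mathcal T^*(\mathcal T(\sigma)^{-1/2}Y\,\mathcal T(\sigma)^{-1/2})\sigma^{1/2}$. Then the following are equivalent: (i) $\widehat D(\rho\|\sigma)=\widehat D(\mathcal T(\rho)\|\mathcal T(\sigma))$. (ii) $\mathcal T_\sigma([\rho/\sigma]^2)=\mathcal T_\sigma([\rho/\sigma])^2$. (iii) There are finitely many finite-dimensional Hilbert spaces $\mathcal K_n^L,\mathcal K_n^R$ and a unitary $S:\operatorname{supp}\mathcal T(\sigma)\to\bigoplus_n\mathcal K_n^L\otimes\mathcal K_n^R$, extended by zero to $\mathcal K$ (so that $S$ is a unitary on $\mathcal K$ if $\mathcal T(\sigma)$ is invertible), positive semidefinite operators $\rho_0,\sigma_0$ on $\mathcal K\otimes\mathcal H_E$ with supports contained in the range of $UU^*$, and positive semidefinite operators $\eta_n^L$ on $\mathcal K_n^L$ and $\eta_n^R$ on $\mathcal K_n^R\otimes\mathcal H_E$, such that $\rho=U^*\rho_0U$, $\sigma=U^*\sigma_0U$, and $$\rho_0=(\mathcal T(\sigma)^{1/2}S^*\otimes I_E)\Big(\bigoplus_n\eta_n^L\otimes\eta_n^R\Big)(S\mathcal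 T(\sigma)^{1/2}\otimes I_E),$$ $$\sigma_0=(\mathcal T(\sigma)^{1/2}S^*\otimes I_E)\Big(\bigoplus_n I_{\mathcal K_n^L}\otimes\eta_n^R\Big)(S\mathcal T(\sigma)^{1/2}\otimes I_E).$$ (iv) $\rho=\sigma\,\mathcal T^*(\mathcal T(\sigma)^{-1}\mathcal T(\rho))$. -/

import Mathlib

open scoped Kronecker ComplexOrder

set_option linter.unusedSectionVars false

noncomputable section

namespace BSEntropy

variable {h k e : Type*} [Fintype h] [DecidableEq h] [Fintype k] [DecidableEq k]
  [Fintype e] [DecidableEq e]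

/-- A state (density matrix) on the Hilbert space with orthonormal basis indexed by `h`. -/
def IsState (ρ : Matrix h h ℂ) : Prop := ρ.PosSemidef ∧ ρ.trace = 1

/-- The support of a positive operator, i.e. its range
(which is the orthogonal complement of its kernel). -/
def supp (A : Matrix h h ℂ) : Submodule ℂ (h → ℂ) := LinearMap.range A.mulVecLin

/-- `A^{1/2}` for a positive operator `A`, by functional calculus. -/
def msqrt (A : Matrix h h ℂ) : Matrix h h ℂ := cfc Real.sqrt A

/-- `A^{-1}` for a positive operator `A`, the inverse being taken on the support of `A`
and extended by `0` (as `0⁻¹ = 0` in `ℝ`); it is the usual inverse if `A` is invertible. -/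
def minv (A : Matrix h h ℂ) : Matrix h h ℂ := cfc (fun x : ℝ => x⁻¹) A

/-- `A^{-1/2}` for a positive operator `A`, the inverse being taken on the support of `A`. -/
def minvSqrt (A : Matrix h h ℂ) : Matrix h h ℂ := cfc (fun x : ℝ => (Real.sqrt x)⁻¹) A

open Classical in
/-- The orthogonal projection onto the support of a positive operator. -/
def suppProj (A : Matrix h h ℂ) : Matrix h h ℂ := cfc (fun x : ℝ => if x = 0 then 0 else 1) A

open Classical in
/-- The Belavkin-Staszewski entropy `tr[ρ log (ρ^{1/2} σ⁻¹ ρ^{1/2})]` if `ker σ ⊆ ker ρ`, and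
`+∞` otherwise. Since `Real.log 0 = 0` the logarithm is taken on the support of
`ρ^{1/2} σ⁻¹ ρ^{1/2}`, which is the support of `ρ` in the first case. -/
def bsEntropy (ρ σ : Matrix h h ℂ) : EReal :=
  if LinearMap.ker σ.mulVecLin ≤ LinearMap.ker ρ.mulVecLin then
    (((ρ * cfc Real.log (msqrt ρ * minv σ * msqrt ρ)).trace.re : ℝ) : EReal)
  else ⊤

/-- The partial trace over the second tensor factor. -/
def trE (X : Matrix (k × e) (k × e) ℂ) : Matrix k k ℂ :=
  Matrix.of fun i j => ∑ x : e, X (i, x) (j, x)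

/-- The adjoint `T^*` of a linear map for the Hilbert-Schmidt inner products
`⟨X, Y⟩ = tr[Xᴴ Y]`, see `trace_hsAdjoint`. -/
def hsAdjoint (T : Matrix h h ℂ →ₗ[ℂ] Matrix k k ℂ) (Y : Matrix k k ℂ) : Matrix h h ℂ :=
  Matrix.of fun i j => star ((Y.conjTranspose * T (Matrix.single i j 1)).trace)

theorem trace_hsAdjoint (T : Matrix h h ℂ →ₗ[ℂ] Matrix k k ℂ) (Y : Matrix k k ℂ)
    (X : Matrix h h ℂ) :
    ((hsAdjoint T Y).conjTranspose * X).trace = (Y.conjTranspose * T X).trace := by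
  conv_rhs => rw [Matrix.matrix_eq_sum_single X]
  simp only [map_sum, Matrix.mul_sum, Matrix.trace_sum]
  rw [Matrix.trace, Finset.sum_congr rfl (fun i _ => Matrix.diag_apply _ i)]
  simp only [Matrix.mul_apply, Matrix.conjTranspose_apply, hsAdjoint, Matrix.of_apply, star_star]
  rw [Finset.sum_comm]
  refine Finset.sum_congr rfl fun i _ => Finset.sum_congr rfl fun j _ => ?_
  have : Matrix.single i j (X i j) = X i j • Matrix.single i j (1 : ℂ) := by simp
  rw [this, map_smul, Matrix.mul_smul, Matrix.trace_smul, smul_eq_mul, mul_comm]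

/-- `[ρ/σ] = σ^{-1/2} ρ σ^{-1/2}`. -/
def quot (ρ σ : Matrix h h ℂ) : Matrix h h ℂ := minvSqrt σ * ρ * minvSqrt σ

/-- The Petz recovery map of `T` and `σ`. -/
def petzMap (T : Matrix h h ℂ →ₗ[ℂ] Matrix k k ℂ) (σ : Matrix h h ℂ) (Y : Matrix k k ℂ) :
    Matrix h h ℂ :=
  msqrt σ * hsAdjoint T (minvSqrt (T σ) * Y * minvSqrt (T σ)) * msqrt σ

/-- The map `T_σ = T(σ)^{-1/2} T(σ^{1/2} · σ^{1/2}) T(σ)^{-1/2}`; it is the adjoint of the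
Petz recovery map, see `trace_petzMap`. -/
def petzAdjoint (T : Matrix h h ℂ →ₗ[ℂ] Matrix k k ℂ) (σ : Matrix h h ℂ) (X : Matrix h h ℂ) :
    Matrix k k ℂ :=
  minvSqrt (T σ) * T (msqrt σ * X * msqrt σ) * minvSqrt (T σ)

theorem trace_petzMap (T : Matrix h h ℂ →ₗ[ℂ] Matrix k k ℂ) (σ : Matrix h h ℂ)
    (Y : Matrix k k ℂ) (X : Matrix h h ℂ) :
    ((petzMap T σ Y).conjTranspose * X).trace
      = (Y.conjTranspose * petzAdjoint T σ X).trace := by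
  have h1 : (msqrt σ).conjTranspose = msqrt σ := (cfc_predicate (R := ℝ) Real.sqrt σ)
  have h2 : (minvSqrt (T σ)).conjTranspose = minvSqrt (T σ) :=
    (cfc_predicate (R := ℝ) (fun x : ℝ => (Real.sqrt x)⁻¹) (T σ))
  have h3 := trace_hsAdjoint T (minvSqrt (T σ) * Y * minvSqrt (T σ)) (msqrt σ * X * msqrt σ)
  simp only [petzMap, petzAdjoint, Matrix.conjTranspose_mul, h1, h2] at h3 ⊢
  calc _ = (msqrt σ * ((hsAdjoint T (minvSqrt (T σ) * Y * minvSqrt (T σ))).conjTranspose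
            * (msqrt σ * X))).trace := by simp only [Matrix.mul_assoc]
    _ = ((hsAdjoint T (minvSqrt (T σ) * Y * minvSqrt (T σ))).conjTranspose
            * (msqrt σ * X * msqrt σ)).trace := by
          rw [Matrix.trace_mul_comm]; simp only [Matrix.mul_assoc]
    _ = _ := by
          rw [h3, Matrix.mul_assoc, Matrix.trace_mul_comm]; simp only [Matrix.mul_assoc]

/-- The basis of `⨁ n, K_n^L ⊗ K_n^R`, where `dim K_n^L = dL n` and `dim K_n^R = dR n`. -/
abbrev BlockIndex {N : ℕ} (dL dR : Fin N → ℕ) : Type := Σ n : Fin N, Fin (dL n) × Fin (dR n)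

/-- The operator `⨁ n, A n ⊗ B n` on `(⨁ n, K_n^L ⊗ K_n^R) ⊗ H_E`, where `A n` acts on `K_n^L`
and `B n` acts on `K_n^R ⊗ H_E`. -/
def blockSum {N : ℕ} {dL dR : Fin N → ℕ}
    (A : ∀ n, Matrix (Fin (dL n)) (Fin (dL n)) ℂ)
    (B : ∀ n, Matrix (Fin (dR n) × e) (Fin (dR n) × e) ℂ) :
    Matrix (BlockIndex dL dR × e) (BlockIndex dL dR × e) ℂ :=
  (Matrix.blockDiagonal' fun n => A n ⊗ₖ B n).submatrix
    (fun i => ⟨i.1.1, (i.1.2.1, (i.1.2.2, i.2))⟩)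
    (fun i => ⟨i.1.1, (i.1.2.1, (i.1.2.2, i.2))⟩)

/-- `A ⊗ I_E`. -/
def tensorId (e : Type*) [DecidableEq e] {m n : Type*} (A : Matrix m n ℂ) :
    Matrix (m × e) (n × e) ℂ := A ⊗ₖ (1 : Matrix e e ℂ)

/-- The block decomposition of `ρ` and `σ` through the isometry `U : H → K ⊗ H_E` and a unitary
`S` from the support of `τ = tr_E[U σ Uᴴ]` onto `⨁ n, K_n^L ⊗ K_n^R`. Here `S` is extended by
zero to all of `K`, so that its unitarity reads `S Sᴴ = 1` and `Sᴴ S = suppProj τ`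
(which is `1` if `τ` is invertible). -/
def HasBlockDecomposition (U : Matrix (k × e) h ℂ) (τ : Matrix k k ℂ) (ρ σ : Matrix h h ℂ) :
    Prop :=
  ∃ (N : ℕ) (dL dR : Fin N → ℕ) (S : Matrix (BlockIndex dL dR) k ℂ)
    (ρ₀ σ₀ : Matrix (k × e) (k × e) ℂ)
    (ηL : ∀ n, Matrix (Fin (dL n)) (Fin (dL n)) ℂ)
    (ηR : ∀ n, Matrix (Fin (dR n) × e) (Fin (dR n) × e) ℂ),
    S * S.conjTranspose = 1 ∧ S.conjTranspose * S = suppProj τ ∧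
    ρ₀.PosSemidef ∧ σ₀.PosSemidef ∧
    supp ρ₀ ≤ supp (U * U.conjTranspose) ∧ supp σ₀ ≤ supp (U * U.conjTranspose) ∧
    ρ = U.conjTranspose * ρ₀ * U ∧ σ = U.conjTranspose * σ₀ * U ∧
    (∀ n, (ηL n).PosSemidef) ∧ (∀ n, (ηR n).PosSemidef) ∧
    ρ₀ = tensorId e (msqrt τ * S.conjTranspose) * blockSum ηL ηR *
      tensorId e (S * msqrt τ) ∧
    σ₀ = tensorId e (msqrt τ * S.conjTranspose) * blockSum (dL := dL) (fun _ => 1) ηR *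
      tensorId e (S * msqrt τ)

end BSEntropy

end

/-!
Write `A = T σ`, `X = [ρ/σ]` and `B = [T ρ/T σ]`. The map `T_σ` has the Kraus operators
`K x = A^{-1/2} V x σ^{1/2}` (`petzKraus`), where `V x` are the Kraus operators of `T`; they satisfy
`∑ K Kᴴ = P`, the support projection of `A`, and `∑ K X Kᴴ = B`. All four conditions are equivalent
to the intertwining relation `X (K x)ᴴ = (K x)ᴴ B` for all `x` (`KrausIntertwines`).

* Multiplicativity: `T_σ(X²) - B² = ∑ (X Kᴴ - Kᴴ B)ᴴ (X Kᴴ - Kᴴ B)` (`sum_conj_sq_sub_sq`).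
* Entropy: with `f x = x log x` the two entropies are `tr[σ f(X)] = tr[A T_σ(f(X))]` and
  `tr[A f(B)]` (`trace_entropy_eq`). For the resolvents there is again a sum of squares,
  `T_σ((X + t)⁻¹) - P (B + t)⁻¹ = ∑ Gᴴ (X + t) G` with `G = (X + t)⁻¹ Kᴴ - Kᴴ (B + t)⁻¹`
  (`sum_conj_resolvent_sub`). The difference of the entropies, with `x log x` replaced by
  `x log (x + t)`, is antitone in `t` because its derivative is `-t` times the trace of this defect,
  and it tends to `0` at infinity. If it vanishes at `t = 0`, the defect vanishes
  (`sum_resolvent_eq_of_sum_entropy_eq`), so `G = 0`, which is the intertwining relation.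
  Conversely, intertwiners pass through the functional calculus (`cfc_intertwine`).
* Recovery: the relation gives the formula for `ρ` after multiplication by `A^{1/2} V x` and
  summation; the formula gives `tr[A T_σ(X²)] = tr[A B²]`, hence multiplicativity (`recovery_iff`).
* Block decomposition: the relation says that `B ⊗ I` commutes with `W Wᴴ` for
  `W = (A^{-1/2} ⊗ I) U σ^{1/2}` and that `W X Wᴴ = (B ⊗ I) W Wᴴ`. The eigenspaces of `B` in the
  support of `A` therefore give the decomposition, with all the left factors one-dimensional
  (`hasBlockDecomposition_of_intertwines`). Conversely, a block decomposition yields the recovery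
  formula by direct computation (`recovery_of_hasBlockDecomposition`).
-/

namespace BSEntropy

open Matrix

/-! ### Functional calculus of Hermitian matrices -/

section FunctionalCalculus

variable {m n : Type*} [Fintype m] [DecidableEq m] [Fintype n] [DecidableEq n]

lemma continuousOn_spectrum (f : ℝ → ℝ) (A : Matrix n n ℂ) : ContinuousOn f (spectrum ℝ A) :=
  Matrix.finite_real_spectrum.continuousOn f

lemma nonneg_of_mem_spectrum {A : Matrix n n ℂ} (hA : A.PosSemidef) {x : ℝ}
    (hx : x ∈ spectrum ℝ A) : 0 ≤ x := by
  rw [hA.1.spectrum_real_eq_range_eigenvalues] at hx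
  obtain ⟨i, rfl⟩ := hx
  exact hA.eigenvalues_nonneg i

lemma cfc_mul_cfc (f g : ℝ → ℝ) (A : Matrix n n ℂ) :
    cfc f A * cfc g A = cfc (fun x => f x * g x) A :=
  (cfc_mul f g A (continuousOn_spectrum f A) (continuousOn_spectrum g A)).symm

lemma cfc_congr_of_nonneg {f g : ℝ → ℝ} {A : Matrix n n ℂ} (hA : A.PosSemidef)
    (hfg : ∀ x, 0 ≤ x → f x = g x) : cfc f A = cfc g A :=
  cfc_congr fun _ hx => hfg _ (nonneg_of_mem_spectrum hA hx)

lemma cfc_id_eq {A : Matrix n n ℂ} (hA : A.IsHermitian) : cfc (fun x : ℝ => x) A = A :=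
  cfc_id' ℝ A hA

lemma isHermitian_cfc (f : ℝ → ℝ) (A : Matrix n n ℂ) : (cfc f A).IsHermitian :=
  cfc_predicate (R := ℝ) f A

/-- An intertwiner of two Hermitian matrices intertwines their functional calculi. On the finite
union of the two spectra every function agrees with a polynomial, and for polynomials the claim is
an induction. -/
lemma cfc_intertwine {C : Matrix n n ℂ} {D : Matrix m m ℂ} (hC : C.IsHermitian)
    (hD : D.IsHermitian) {Z : Matrix m n ℂ} (h : Z * C = D * Z) (f : ℝ → ℝ) :
    Z * cfc f C = cfc f D * Z := by
  classical
  let s : Finset ℝ := (Matrix.finite_real_spectrum (A := C)).toFinset ∪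
    (Matrix.finite_real_spectrum (A := D)).toFinset
  let q : Polynomial ℝ := Lagrange.interpolate s id f
  have hq : ∀ x ∈ s, f x = q.eval x := fun x hx =>
    (Lagrange.eval_interpolate_at_node f (Function.injective_id.injOn) hx).symm
  have h1 : cfc f C = Polynomial.aeval C q := by
    rw [← cfc_polynomial q C hC]
    exact cfc_congr fun x hx => hq x (by simp [s, hx])
  have h2 : cfc f D = Polynomial.aeval D q := by
    rw [← cfc_polynomial q D hD]
    exact cfc_congr fun x hx => hq x (by simp [s, hx])
  rw [h1, h2]
  induction q using Polynomial.induction_on' with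
  | add p r hp hr => simp only [map_add, Matrix.mul_add, Matrix.add_mul, hp, hr]
  | monomial j a =>
    have hpow : Z * C ^ j = D ^ j * Z := by
      induction j with
      | zero => simp
      | succ j ih => rw [pow_succ, ← Matrix.mul_assoc, ih, Matrix.mul_assoc, h, pow_succ,
          Matrix.mul_assoc]
    simp only [Polynomial.aeval_monomial, Algebra.algebraMap_eq_smul_one, smul_mul_assoc, one_mul,
      Matrix.mul_smul, Matrix.smul_mul, hpow]

/-- In an eigenbasis, `tr[M f(X)]` is a combination of the values of `f` at the eigenvalues whose
coefficients do not depend on `f`. -/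
lemma exists_trace_mul_cfc {X : Matrix n n ℂ} (hX : X.PosSemidef) (M : Matrix n n ℂ) :
    ∃ w x : n → ℝ, (∀ i, 0 ≤ x i) ∧
      ∀ f : ℝ → ℝ, (M * cfc f X).trace.re = ∑ i, w i * f (x i) := by
  set Q : Matrix n n ℂ := (hX.1.eigenvectorUnitary : Matrix n n ℂ)
  refine ⟨fun i => ((star Q * M * Q) i i).re, hX.1.eigenvalues, hX.eigenvalues_nonneg, fun f => ?_⟩
  rw [hX.1.cfc_eq f, Matrix.IsHermitian.cfc, Unitary.conjStarAlgAut_apply]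
  have h : (M * (Q * diagonal (RCLike.ofReal ∘ f ∘ hX.1.eigenvalues) * star Q)).trace
      = (star Q * M * Q * diagonal (RCLike.ofReal ∘ f ∘ hX.1.eigenvalues)).trace := by
    rw [← Matrix.mul_assoc, Matrix.trace_mul_comm]; simp only [Matrix.mul_assoc]
  refine (congrArg Complex.re h).trans ?_
  simp [Matrix.trace, Matrix.mul_diagonal]

/-! ### Square roots, inverses and supports -/

lemma isHermitian_msqrt (A : Matrix n n ℂ) : (msqrt A).IsHermitian := isHermitian_cfc _ A

lemma isHermitian_minvSqrt (A : Matrix n n ℂ) : (minvSqrt A).IsHermitian := isHermitian_cfc _ A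

lemma isHermitian_suppProj (A : Matrix n n ℂ) : (suppProj A).IsHermitian := isHermitian_cfc _ A

lemma msqrt_mul_msqrt {A : Matrix n n ℂ} (hA : A.PosSemidef) : msqrt A * msqrt A = A := by
  rw [msqrt, cfc_mul_cfc, cfc_congr_of_nonneg hA fun x hx => Real.mul_self_sqrt hx,
    cfc_id_eq hA.1]

lemma msqrt_mul_msqrt_mul {A : Matrix n n ℂ} (hA : A.PosSemidef) (N : Matrix n m ℂ) :
    msqrt A * (msqrt A * N) = A * N := by
  rw [← Matrix.mul_assoc, msqrt_mul_msqrt hA]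

lemma minvSqrt_mul_minvSqrt {A : Matrix n n ℂ} (hA : A.PosSemidef) :
    minvSqrt A * minvSqrt A = minv A := by
  rw [minvSqrt, cfc_mul_cfc, minv]
  exact cfc_congr_of_nonneg hA fun x hx => by rw [← mul_inv, Real.mul_self_sqrt hx]

lemma msqrt_mul_minvSqrt {A : Matrix n n ℂ} (hA : A.PosSemidef) :
    msqrt A * minvSqrt A = suppProj A := by
  rw [msqrt, minvSqrt, cfc_mul_cfc, suppProj]
  refine cfc_congr_of_nonneg hA fun x hx => ?_
  by_cases h : x = 0
  · simp [h]
  · rw [if_neg h, mul_inv_cancel₀ (Real.sqrt_ne_zero'.2 (lt_of_le_of_ne hx (Ne.symm h)))]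

lemma minvSqrt_mul_msqrt {A : Matrix n n ℂ} (hA : A.PosSemidef) :
    minvSqrt A * msqrt A = suppProj A := by
  rw [← msqrt_mul_minvSqrt hA]
  exact (cfc_commute_cfc _ _ A).eq

lemma suppProj_mul_suppProj (A : Matrix n n ℂ) : suppProj A * suppProj A = suppProj A := by
  rw [suppProj, cfc_mul_cfc]
  congr 1; ext x; simp

lemma suppProj_mul_minvSqrt (A : Matrix n n ℂ) : suppProj A * minvSqrt A = minvSqrt A := by
  rw [suppProj, minvSqrt, cfc_mul_cfc]
  congr 1; ext x
  by_cases h : x = 0 <;> simp [h]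

lemma minvSqrt_mul_suppProj (A : Matrix n n ℂ) : minvSqrt A * suppProj A = minvSqrt A := by
  conv_rhs => rw [← suppProj_mul_minvSqrt]
  exact (cfc_commute_cfc _ _ A).eq

lemma suppProj_mul_msqrt (A : Matrix n n ℂ) : suppProj A * msqrt A = msqrt A := by
  rw [suppProj, msqrt, cfc_mul_cfc]
  congr 1; ext x
  by_cases h : x = 0 <;> simp [h]

lemma msqrt_mul_suppProj (A : Matrix n n ℂ) : msqrt A * suppProj A = msqrt A := by
  conv_rhs => rw [← suppProj_mul_msqrt]
  exact (cfc_commute_cfc _ _ A).eq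

lemma suppProj_mul_self {A : Matrix n n ℂ} (hA : A.PosSemidef) : suppProj A * A = A := by
  nth_rewrite 2 [← msqrt_mul_msqrt hA]
  rw [← Matrix.mul_assoc, suppProj_mul_msqrt, msqrt_mul_msqrt hA]

lemma self_mul_suppProj {A : Matrix n n ℂ} (hA : A.PosSemidef) : A * suppProj A = A := by
  nth_rewrite 1 [← msqrt_mul_msqrt hA]
  rw [Matrix.mul_assoc, msqrt_mul_suppProj, msqrt_mul_msqrt hA]

lemma minv_mul_self {A : Matrix n n ℂ} (hA : A.PosSemidef) : minv A * A = suppProj A := by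
  rw [← minvSqrt_mul_minvSqrt hA]
  nth_rewrite 3 [← msqrt_mul_msqrt hA]
  rw [Matrix.mul_assoc, ← Matrix.mul_assoc _ (msqrt A), minvSqrt_mul_msqrt hA, suppProj_mul_msqrt,
    minvSqrt_mul_msqrt hA]

lemma mul_eq_of_supp_le {E A R : Matrix n n ℂ} (hE : E * A = A) (h : supp R ≤ supp A) :
    E * R = R := by
  refine Matrix.toLin'.injective (LinearMap.ext fun v => ?_)
  obtain ⟨w, hw⟩ := h (LinearMap.mem_range_self R.mulVecLin v)
  simp only [Matrix.mulVecLin_apply] at hw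
  rw [Matrix.toLin'_apply, Matrix.toLin'_apply, ← Matrix.mulVec_mulVec, ← hw,
    Matrix.mulVec_mulVec, hE]

lemma mul_eq_of_conjTranspose {A R : Matrix n n ℂ} (hA : A.IsHermitian) (hR : R.IsHermitian)
    (h : A * R = R) : R * A = R := by
  have := congrArg conjTranspose h
  rwa [conjTranspose_mul, hA.eq, hR.eq] at this

lemma ker_le_of_mul_suppProj {R A : Matrix n n ℂ} (hA : A.PosSemidef) (h : R * suppProj A = R) :
    LinearMap.ker A.mulVecLin ≤ LinearMap.ker R.mulVecLin := by
  intro v hv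
  rw [LinearMap.mem_ker, Matrix.mulVecLin_apply] at hv ⊢
  rw [← h, ← minv_mul_self hA, ← Matrix.mulVec_mulVec, ← Matrix.mulVec_mulVec, hv]
  simp

end FunctionalCalculus

/-! ### The entropy as a trace of a function of the quotient -/

section Entropy

variable {n : Type*} [Fintype n] [DecidableEq n]

lemma posSemidef_quot {R A : Matrix n n ℂ} (hR : R.PosSemidef) : (quot R A).PosSemidef := by
  have := hR.mul_mul_conjTranspose_same (minvSqrt A)
  rwa [(isHermitian_minvSqrt A).eq] at this

lemma msqrt_mul_quot_mul_msqrt {R A : Matrix n n ℂ} (hA : A.PosSemidef)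
    (h : suppProj A * R = R) (h' : R * suppProj A = R) : msqrt A * quot R A * msqrt A = R := by
  have : msqrt A * quot R A * msqrt A
      = (msqrt A * minvSqrt A) * R * (minvSqrt A * msqrt A) := by
    simp only [quot, Matrix.mul_assoc]
  rw [this, msqrt_mul_minvSqrt hA, minvSqrt_mul_msqrt hA, h, h']

/-- With `Z = σ^{-1/2} ρ^{1/2}` one has `Zᴴ Z = ρ^{1/2} σ⁻¹ ρ^{1/2}` and `Z Zᴴ = [ρ/σ]`, and `Z`
intertwines the logarithms of these two. -/
lemma trace_entropy_eq {R A : Matrix n n ℂ} (hR : R.PosSemidef) (hA : A.PosSemidef)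
    (h : suppProj A * R = R) :
    (R * cfc Real.log (msqrt R * minv A * msqrt R)).trace
      = (A * cfc (fun x => x * Real.log x) (quot R A)).trace := by
  set Z := minvSqrt A * msqrt R with hZ
  have hZ1 : msqrt R * minv A * msqrt R = Zᴴ * Z := by
    rw [hZ, conjTranspose_mul, (isHermitian_msqrt R).eq, (isHermitian_minvSqrt A).eq,
      ← minvSqrt_mul_minvSqrt hA]
    simp only [Matrix.mul_assoc]
  have hZ2 : quot R A = Z * Zᴴ := by
    rw [hZ, conjTranspose_mul, (isHermitian_msqrt R).eq, (isHermitian_minvSqrt A).eq, quot]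
    conv_lhs => rw [← msqrt_mul_msqrt hR]
    simp only [Matrix.mul_assoc]
  have hPR : suppProj A * msqrt R = msqrt R := by
    have h0 : (suppProj A * msqrt R - msqrt R) * (suppProj A * msqrt R - msqrt R)ᴴ = 0 := by
      have h1 : (suppProj A * msqrt R - msqrt R) * msqrt R = 0 := by
        rw [Matrix.sub_mul, Matrix.mul_assoc, msqrt_mul_msqrt hR, h, sub_self]
      rw [conjTranspose_sub, conjTranspose_mul, (isHermitian_msqrt R).eq, Matrix.mul_sub,
        ← Matrix.mul_assoc, h1, Matrix.zero_mul, sub_zero]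
    exact sub_eq_zero.1 (Matrix.self_mul_conjTranspose_eq_zero.1 h0)
  have hsZ : msqrt A * Z = msqrt R := by
    rw [hZ, ← Matrix.mul_assoc, msqrt_mul_minvSqrt hA, hPR]
  have hZs : Zᴴ * msqrt A = msqrt R := by
    have := congrArg conjTranspose hsZ
    rwa [conjTranspose_mul, (isHermitian_msqrt A).eq, (isHermitian_msqrt R).eq] at this
  have hZZ : (Z * Zᴴ).IsHermitian := isHermitian_mul_conjTranspose_self Z
  have hint : Z * cfc Real.log (Zᴴ * Z) = cfc Real.log (Z * Zᴴ) * Z :=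
    cfc_intertwine (isHermitian_conjTranspose_mul_self Z) hZZ (by simp only [Matrix.mul_assoc]) _
  rw [hZ1, hZ2]
  calc (R * cfc Real.log (Zᴴ * Z)).trace
      = (msqrt R * cfc Real.log (Zᴴ * Z) * msqrt R).trace := by
        conv_lhs => rw [← msqrt_mul_msqrt hR]
        rw [Matrix.mul_assoc, Matrix.trace_mul_comm]
    _ = (msqrt A * (Z * cfc Real.log (Zᴴ * Z)) * (Zᴴ * msqrt A)).trace := by
        rw [hZs, ← Matrix.mul_assoc (msqrt A), hsZ]
    _ = (msqrt A * (cfc Real.log (Z * Zᴴ) * (Z * Zᴴ)) * msqrt A).trace := by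
        rw [hint]; simp only [Matrix.mul_assoc]
    _ = (A * (cfc Real.log (Z * Zᴴ) * (Z * Zᴴ))).trace := by
        rw [Matrix.trace_mul_comm, ← Matrix.mul_assoc, msqrt_mul_msqrt hA]
    _ = (A * cfc (fun x => x * Real.log x) (Z * Zᴴ)).trace := by
        congr 2
        nth_rewrite 2 [← cfc_id_eq hZZ]
        rw [cfc_mul_cfc]
        congr 1; ext x; ring

end Entropy

/-! ### A scalar monotonicity argument -/

/-- Since `x / (x + t) = 1 - t / (x + t)`, the function
`t ↦ ∑ w x log (x + t) - ∑ m b log (b + t)` is antitone; it tends to `0` at infinity.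
If it vanishes at `t = 0`, it is constant, and so is its derivative zero. -/
lemma sum_resolvent_eq_of_sum_entropy_eq {ι κ : Type*} [Fintype ι] [Fintype κ]
    (w x : ι → ℝ) (m b : κ → ℝ) (hx : ∀ i, 0 ≤ x i) (hb : ∀ j, 0 ≤ b j)
    (h0 : ∑ i, w i = ∑ j, m j) (h1 : ∑ i, w i * x i = ∑ j, m j * b j)
    (hr : ∀ t : ℝ, 0 < t → ∑ j, m j * (b j + t)⁻¹ ≤ ∑ i, w i * (x i + t)⁻¹)
    (he : ∑ i, w i * (x i * Real.log (x i)) = ∑ j, m j * (b j * Real.log (b j))) :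
    ∑ i, w i * (x i + 1)⁻¹ = ∑ j, m j * (b j + 1)⁻¹ := by
  set F : ℝ → ℝ := fun t => ∑ i, w i * (x i * Real.log (x i + t))
    - ∑ j, m j * (b j * Real.log (b j + t)) with hF
  have hd : ∀ t : ℝ, 0 < t →
      HasDerivAt F (-(t * (∑ i, w i * (x i + t)⁻¹ - ∑ j, m j * (b j + t)⁻¹))) t := by
    intro t ht
    have hterm : ∀ a c : ℝ, 0 ≤ a →
        HasDerivAt (fun t => c * (a * Real.log (a + t))) (c - t * (c * (a + t)⁻¹)) t := by
      intro a c ha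
      have hne : a + t ≠ 0 := by positivity
      have := ((((hasDerivAt_id t).const_add a).log hne).const_mul a).const_mul c
      refine this.congr_deriv ?_
      simp only [id]
      field_simp
      ring
    have := (HasDerivAt.fun_sum fun i (_ : i ∈ Finset.univ) => hterm (x i) (w i) (hx i)).sub
      (HasDerivAt.fun_sum fun j (_ : j ∈ Finset.univ) => hterm (b j) (m j) (hb j))
    refine this.congr_deriv ?_
    simp only [Finset.sum_sub_distrib, ← Finset.mul_sum, h0]
    ring
  have hcont : ContinuousOn F (Set.Ici 0) := by
    have hterm : ∀ a c : ℝ, 0 ≤ a →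
        ContinuousOn (fun t => c * (a * Real.log (a + t))) (Set.Ici 0) := by
      intro a c ha
      rcases ha.eq_or_lt with rfl | ha
      · simpa using continuousOn_const
      · refine continuousOn_const.mul (continuousOn_const.mul (ContinuousOn.log (by fun_prop) ?_))
        intro t ht
        have : (0 : ℝ) ≤ t := ht
        positivity
    exact (continuousOn_finsetSum _ fun i _ => hterm _ _ (hx i)).sub
      (continuousOn_finsetSum _ fun j _ => hterm _ _ (hb j))
  have hanti : AntitoneOn F (Set.Ici 0) := by
    refine antitoneOn_of_deriv_nonpos (convex_Ici 0) hcont ?_ ?_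
    · intro t ht
      rw [interior_Ici] at ht
      exact (hd t ht).differentiableAt.differentiableWithinAt
    · intro t ht
      rw [interior_Ici] at ht
      rw [(hd t ht).deriv]
      have := mul_nonneg (le_of_lt ht) (sub_nonneg.2 (hr t ht))
      linarith
  have hF0 : F 0 = 0 := by simp [hF, he]
  -- As `∑ w x = ∑ m b`, subtracting `log t` from every logarithm does not change `F t`.
  have hlim : Filter.Tendsto F Filter.atTop (nhds 0) := by
    have hlog : ∀ a : ℝ, 0 ≤ a →
        Filter.Tendsto (fun t => Real.log (a + t) - Real.log t) Filter.atTop (nhds 0) := by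
      intro a ha
      have h2 : Filter.Tendsto (fun t : ℝ => 1 + a / t) Filter.atTop (nhds (1 + 0)) :=
        tendsto_const_nhds.add (tendsto_const_nhds.div_atTop Filter.tendsto_id)
      have h3 := h2.log (by norm_num)
      rw [add_zero, Real.log_one] at h3
      refine h3.congr' ?_
      filter_upwards [Filter.eventually_gt_atTop 0] with t ht
      rw [← Real.log_div (by positivity) ht.ne', add_div, div_self ht.ne', add_comm]
    have h4 : Filter.Tendsto (fun t => ∑ i, w i * (x i * (Real.log (x i + t) - Real.log t))
        - ∑ j, m j * (b j * (Real.log (b j + t) - Real.log t))) Filter.atTop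
        (nhds (∑ i, w i * (x i * 0) - ∑ j, m j * (b j * 0))) :=
      (tendsto_finsetSum _ fun i _ => ((hlog _ (hx i)).const_mul _).const_mul _).sub
        (tendsto_finsetSum _ fun j _ => ((hlog _ (hb j)).const_mul _).const_mul _)
    simp only [mul_zero, Finset.sum_const_zero, sub_zero] at h4
    refine h4.congr fun t => ?_
    simp only [hF, mul_sub, Finset.sum_sub_distrib, ← mul_assoc, ← Finset.sum_mul, h1]
    ring
  have hzero : ∀ t : ℝ, 0 < t → F t = 0 := by
    intro t ht
    refine le_antisymm (hF0 ▸ hanti (Set.mem_Ici.2 le_rfl) ht.le ht.le) ?_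
    refine le_of_tendsto hlim ?_
    filter_upwards [Filter.eventually_ge_atTop t] with s hs
    exact hanti ht.le (ht.le.trans hs) hs
  have hd1 := hd 1 one_pos
  -- `F` vanishes on `(0, ∞)`, so its derivative at `1` is zero.
  have hd2 : HasDerivAt F 0 1 := by
    refine (hasDerivAt_const (1 : ℝ) (0 : ℝ)).congr_of_eventuallyEq ?_
    filter_upwards [lt_mem_nhds (zero_lt_one' ℝ)] with t ht using hzero t ht
  have := hd1.unique hd2
  linarith

/-! ### Equality in the operator Jensen inequality -/

section Jensen

variable {m n : Type*} [Fintype m] [DecidableEq m] [Fintype n] [DecidableEq n]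

/-- `X (X + t)⁻¹ = 1 - t (X + t)⁻¹`. -/
lemma mul_cfc_resolvent {X : Matrix n n ℂ} (hX : X.PosSemidef) {t : ℝ} (ht : 0 < t) :
    X * cfc (fun x : ℝ => (x + t)⁻¹) X = 1 - t • cfc (fun x : ℝ => (x + t)⁻¹) X := by
  rw [eq_sub_iff_add_eq, ← cfc_smul t (fun x : ℝ => (x + t)⁻¹) X (continuousOn_spectrum _ _)]
  nth_rewrite 1 [← cfc_id_eq hX.1]
  rw [cfc_mul_cfc, ← cfc_add X _ _ (continuousOn_spectrum _ _) (continuousOn_spectrum _ _),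
    ← cfc_const_one ℝ X hX.1]
  refine cfc_congr_of_nonneg hX fun x hx => ?_
  have : x + t ≠ 0 := by positivity
  simp only [smul_eq_mul]
  field_simp

lemma cfc_resolvent_mul {X : Matrix n n ℂ} (hX : X.PosSemidef) {t : ℝ} (ht : 0 < t) :
    cfc (fun x : ℝ => (x + t)⁻¹) X * X = 1 - t • cfc (fun x : ℝ => (x + t)⁻¹) X := by
  rw [← mul_cfc_resolvent hX ht]
  exact (cfc_intertwine hX.1 hX.1 rfl _).symm

lemma trace_mul_conj_eq {A : Matrix m m ℂ} (hA : A.PosSemidef) (Y : Matrix n n ℂ)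
    (G : Matrix n m ℂ) :
    (A * (Gᴴ * Y * G)).trace = ((G * msqrt A)ᴴ * Y * (G * msqrt A)).trace := by
  rw [conjTranspose_mul, (isHermitian_msqrt A).eq]
  nth_rewrite 1 [← msqrt_mul_msqrt hA]
  rw [Matrix.mul_assoc, Matrix.trace_mul_comm]
  simp only [Matrix.mul_assoc]

lemma re_trace_mul_conj_nonneg {A : Matrix m m ℂ} (hA : A.PosSemidef) {Y : Matrix n n ℂ}
    (hY : Y.PosSemidef) (G : Matrix n m ℂ) : 0 ≤ (A * (Gᴴ * Y * G)).trace.re := by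
  rw [trace_mul_conj_eq hA]
  exact (Complex.le_def.1 (hY.conjTranspose_mul_mul_same (G * msqrt A)).trace_nonneg).1

/-- The functional `tr[A ·]` is faithful on the support of `A`. -/
lemma eq_zero_of_sum_re_trace_nonpos {e : Type*} [Fintype e] {A : Matrix m m ℂ}
    (hA : A.PosSemidef) (G : e → Matrix n m ℂ) (hG : ∀ x, G x * suppProj A = G x)
    (h : ∑ x, (A * ((G x)ᴴ * G x)).trace.re ≤ 0) (x : e) : G x = 0 := by
  have hnn : ∀ y, 0 ≤ (A * ((G y)ᴴ * G y)).trace.re := fun y => by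
    have := re_trace_mul_conj_nonneg hA (Matrix.PosSemidef.one (n := n) (R := ℂ)) (G y)
    rwa [Matrix.mul_one] at this
  have hx := (Finset.sum_eq_zero_iff_of_nonneg fun y _ => hnn y).1
    (le_antisymm h (Finset.sum_nonneg fun y _ => hnn y)) x (Finset.mem_univ x)
  have h1 := trace_mul_conj_eq hA (1 : Matrix n n ℂ) (G x)
  rw [Matrix.mul_one, Matrix.mul_one] at h1
  have h2 : ((G x * msqrt A)ᴴ * (G x * msqrt A)).trace = 0 := by
    have h3 := Complex.le_def.1 (posSemidef_conjTranspose_mul_self (G x * msqrt A)).trace_nonneg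
    refine Complex.ext (by rw [← h1]; exact hx) h3.2.symm
  rw [trace_conjTranspose_mul_self_eq_zero_iff] at h2
  rw [← hG x, ← msqrt_mul_minvSqrt hA, ← Matrix.mul_assoc, h2, Matrix.zero_mul]

variable {e : Type*} [Fintype e] (K : e → Matrix m n ℂ) (X : Matrix n n ℂ)

lemma trace_sum_conj_mul (A : Matrix m m ℂ) (Y : Matrix n n ℂ) :
    ((∑ x, (K x)ᴴ * A * K x) * Y).trace = (A * ∑ x, K x * Y * (K x)ᴴ).trace := by
  rw [Matrix.sum_mul, Matrix.mul_sum, Matrix.trace_sum, Matrix.trace_sum]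
  refine Finset.sum_congr rfl fun x _ => ?_
  rw [Matrix.mul_assoc, Matrix.mul_assoc, Matrix.trace_mul_comm]
  simp only [Matrix.mul_assoc]

lemma posSemidef_sum_conj {X : Matrix n n ℂ} (hX : X.PosSemidef) :
    (∑ x, K x * X * (K x)ᴴ).PosSemidef :=
  posSemidef_sum _ fun x _ => hX.mul_mul_conjTranspose_same (K x)

/-- The defect of multiplicativity of `∑ K · Kᴴ` at `X` is a sum of squares. -/
lemma sum_conj_sq_sub_sq {P B : Matrix m m ℂ} (hX : X.IsHermitian) (hB : B.IsHermitian)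
    (hP : ∑ x, K x * (K x)ᴴ = P) (hBX : ∑ x, K x * X * (K x)ᴴ = B) (hPB : P * B = B) :
    ∑ x, K x * X ^ 2 * (K x)ᴴ - B ^ 2
      = ∑ x, (X * (K x)ᴴ - (K x)ᴴ * B)ᴴ * (X * (K x)ᴴ - (K x)ᴴ * B) := by
  have h1 : ∀ x, (X * (K x)ᴴ - (K x)ᴴ * B)ᴴ * (X * (K x)ᴴ - (K x)ᴴ * B)
      = K x * X ^ 2 * (K x)ᴴ - (K x * X * (K x)ᴴ) * B - B * (K x * X * (K x)ᴴ)
        + B * (K x * (K x)ᴴ) * B := by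
    intro x
    simp only [conjTranspose_sub, conjTranspose_mul, conjTranspose_conjTranspose, hX.eq, hB.eq,
      Matrix.sub_mul, Matrix.mul_sub, pow_two, Matrix.mul_assoc]
    abel
  simp only [h1, Finset.sum_add_distrib, Finset.sum_sub_distrib, ← Matrix.sum_mul,
    ← Matrix.mul_sum, hP, hBX]
  rw [Matrix.mul_assoc B P B, hPB, pow_two B]
  abel

lemma sum_conj_sq_eq_of_intertwine {P B : Matrix m m ℂ} (hX : X.IsHermitian) (hB : B.IsHermitian)
    (hP : ∑ x, K x * (K x)ᴴ = P) (hBX : ∑ x, K x * X * (K x)ᴴ = B) (hPB : P * B = B)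
    (h : ∀ x, X * (K x)ᴴ = (K x)ᴴ * B) : ∑ x, K x * X ^ 2 * (K x)ᴴ = B ^ 2 := by
  rw [← sub_eq_zero, sum_conj_sq_sub_sq K X hX hB hP hBX hPB]
  simp [h]

lemma intertwine_of_trace_sq_eq {A B : Matrix m m ℂ} (hA : A.PosSemidef) (hX : X.IsHermitian)
    (hB : B.IsHermitian) (hP : ∑ x, K x * (K x)ᴴ = suppProj A)
    (hKP : ∀ x, (K x)ᴴ * suppProj A = (K x)ᴴ) (hBX : ∑ x, K x * X * (K x)ᴴ = B)
    (hPB : suppProj A * B = B)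
    (h : (A * ∑ x, K x * X ^ 2 * (K x)ᴴ).trace = (A * B ^ 2).trace) (x : e) :
    X * (K x)ᴴ = (K x)ᴴ * B := by
  rw [← sub_eq_zero]
  have hBP := mul_eq_of_conjTranspose (isHermitian_suppProj A) hB hPB
  refine eq_zero_of_sum_re_trace_nonpos hA (fun x => X * (K x)ᴴ - (K x)ᴴ * B) (fun y => ?_) ?_ x
  · rw [Matrix.sub_mul, Matrix.mul_assoc, Matrix.mul_assoc, hKP, hBP]
  · rw [← Complex.re_sum, ← Matrix.trace_sum, ← Matrix.mul_sum,
      ← sum_conj_sq_sub_sq K X hX hB hP hBX hPB, Matrix.mul_sub, Matrix.trace_sub, h, sub_self]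
    simp

/-- The defect in the Jensen inequality for the resolvent, `R = (X + t)⁻¹` and `S = (B + t)⁻¹`, is
a sum of squares with respect to `X + t`. -/
lemma sum_conj_resolvent_sub {P B S : Matrix m m ℂ} {X Q : Matrix n n ℂ} {t : ℝ}
    (hP : ∑ x, K x * (K x)ᴴ = P) (hBX : ∑ x, K x * X * (K x)ᴴ = B) (hPB : P * B = B)
    (hQ : Q.IsHermitian) (hS : S.IsHermitian)
    (hXQ : X * Q = 1 - t • Q) (hQX : Q * X = 1 - t • Q) (hBS : B * S = 1 - t • S) :
    ∑ x, K x * Q * (K x)ᴴ - P * S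
      = ∑ x, ((Q * (K x)ᴴ - (K x)ᴴ * S)ᴴ * X * (Q * (K x)ᴴ - (K x)ᴴ * S)
        + t • ((Q * (K x)ᴴ - (K x)ᴴ * S)ᴴ * (Q * (K x)ᴴ - (K x)ᴴ * S))) := by
  have h1 : ∀ x, (Q * (K x)ᴴ - (K x)ᴴ * S)ᴴ * X * (Q * (K x)ᴴ - (K x)ᴴ * S)
        + t • ((Q * (K x)ᴴ - (K x)ᴴ * S)ᴴ * (Q * (K x)ᴴ - (K x)ᴴ * S))
      = K x * Q * (K x)ᴴ - K x * (K x)ᴴ * S - S * (K x * (K x)ᴴ)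
        + S * (K x * X * (K x)ᴴ) * S + t • (S * (K x * (K x)ᴴ) * S) := by
    intro x
    have e1 : X * (Q * (K x)ᴴ - (K x)ᴴ * S) + t • (Q * (K x)ᴴ - (K x)ᴴ * S)
        = (K x)ᴴ - X * ((K x)ᴴ * S) - t • ((K x)ᴴ * S) := by
      rw [Matrix.mul_sub, ← Matrix.mul_assoc, hXQ, Matrix.sub_mul, Matrix.one_mul, smul_sub,
        Matrix.smul_mul]
      abel
    have e2 : (Q * (K x)ᴴ - (K x)ᴴ * S)ᴴ = K x * Q - S * K x := by
      simp [hQ.eq, hS.eq]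
    rw [Matrix.mul_assoc, ← Matrix.mul_smul, ← Matrix.mul_add, e1, e2]
    have e3 : K x * Q * (X * ((K x)ᴴ * S))
        = K x * (K x)ᴴ * S - t • (K x * Q * ((K x)ᴴ * S)) := by
      rw [Matrix.mul_assoc, ← Matrix.mul_assoc Q, hQX]
      simp only [Matrix.sub_mul, Matrix.one_mul, Matrix.mul_sub, Matrix.mul_assoc, Matrix.smul_mul,
        Matrix.mul_smul]
    rw [Matrix.mul_sub, Matrix.mul_sub, Matrix.sub_mul, Matrix.sub_mul, Matrix.sub_mul, e3]
    simp only [Matrix.mul_smul, Matrix.mul_assoc]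
    abel
  simp only [h1, Finset.sum_add_distrib, Finset.sum_sub_distrib, ← Matrix.sum_mul,
    ← Matrix.mul_sum, hP, hBX, ← Finset.smul_sum]
  have e4 : B * S + t • (P * S) = P := by
    rw [← hPB, Matrix.mul_assoc, hBS]; simp [Matrix.mul_sub]
  have e5 : S * B * S + t • (S * P * S) = S * P := by
    rw [Matrix.mul_assoc, Matrix.mul_assoc, ← Matrix.mul_smul, ← Matrix.mul_add, e4]
  rw [add_assoc, e5]
  abel

/-- Equality of the traces of `x log x` forces equality in the Jensen inequality for the resolvent,
hence that every `(K x)ᴴ` intertwines `B = ∑ K X Kᴴ` and `X`. -/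
lemma intertwine_of_trace_entropy_eq {A B : Matrix m m ℂ} (hA : A.PosSemidef)
    (hX : X.PosSemidef) (hP : ∑ x, K x * (K x)ᴴ = suppProj A)
    (hKP : ∀ x, (K x)ᴴ * suppProj A = (K x)ᴴ) (hBX : ∑ x, K x * X * (K x)ᴴ = B)
    (hPB : suppProj A * B = B)
    (h : ((∑ x, (K x)ᴴ * A * K x) * cfc (fun x => x * Real.log x) X).trace.re
      = (A * cfc (fun x => x * Real.log x) B).trace.re) (x : e) :
    X * (K x)ᴴ = (K x)ᴴ * B := by
  have hB : B.PosSemidef := hBX ▸ posSemidef_sum_conj K hX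
  have hBP := mul_eq_of_conjTranspose (isHermitian_suppProj A) hB.1 hPB
  set M := ∑ x, (K x)ᴴ * A * K x with hM
  let G : ℝ → e → Matrix n m ℂ := fun t x =>
    cfc (fun x : ℝ => (x + t)⁻¹) X * (K x)ᴴ - (K x)ᴴ * cfc (fun x : ℝ => (x + t)⁻¹) B
  have key : ∀ t : ℝ, 0 < t →
      (M * cfc (fun x : ℝ => (x + t)⁻¹) X).trace.re
          - (A * cfc (fun x : ℝ => (x + t)⁻¹) B).trace.re
        = ∑ x, ((A * ((G t x)ᴴ * X * G t x)).trace.re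
          + t * (A * ((G t x)ᴴ * G t x)).trace.re) := by
    intro t ht
    have h1 := sum_conj_resolvent_sub K hP hBX hPB (isHermitian_cfc _ X)
      (isHermitian_cfc _ B) (mul_cfc_resolvent hX ht) (cfc_resolvent_mul hX ht)
      (mul_cfc_resolvent hB ht)
    have h2 := congrArg (fun Y => (A * Y).trace.re) h1
    simp only [Matrix.mul_sub, Matrix.trace_sub, Complex.sub_re] at h2
    rw [← trace_sum_conj_mul, ← Matrix.mul_assoc A, self_mul_suppProj hA] at h2
    rw [h2, Matrix.mul_sum, Matrix.trace_sum, Complex.re_sum]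
    refine Finset.sum_congr rfl fun y _ => ?_
    simp only [Matrix.mul_sub, Matrix.mul_add, Matrix.trace_add, Complex.add_re, Matrix.mul_smul,
      Matrix.trace_smul, Complex.smul_re, smul_eq_mul, G]
  obtain ⟨w, a, ha, hw⟩ := exists_trace_mul_cfc hX M
  obtain ⟨v, b, hb, hv⟩ := exists_trace_mul_cfc hB A
  -- The hypotheses of the scalar argument come from `f = 1`, `f = id`, the resolvents and
  -- `f x = x log x`.
  have h0 : ∑ i, w i = ∑ j, v j := by
    have h1 := hw fun _ => 1
    have h2 := hv fun _ => 1
    rw [show cfc (fun _ : ℝ => (1 : ℝ)) X = 1 from cfc_const_one ℝ X hX.1, trace_sum_conj_mul] at h1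
    rw [show cfc (fun _ : ℝ => (1 : ℝ)) B = 1 from cfc_const_one ℝ B hB.1, Matrix.mul_one] at h2
    simp only [Matrix.mul_one, mul_one, hP, self_mul_suppProj hA] at h1 h2
    rw [← h1, ← h2]
  have h1 : ∑ i, w i * a i = ∑ j, v j * b j := by
    rw [← hw fun x => x, ← hv fun x => x, cfc_id_eq hX.1, cfc_id_eq hB.1, trace_sum_conj_mul, hBX]
  have hone := sum_resolvent_eq_of_sum_entropy_eq w a v b ha hb h0 h1
    (fun t ht => by
      rw [← hw fun x => (x + t)⁻¹, ← hv fun x => (x + t)⁻¹, ← sub_nonneg, key t ht]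
      refine Finset.sum_nonneg fun y _ => add_nonneg (re_trace_mul_conj_nonneg hA hX _)
        (mul_nonneg ht.le ?_)
      have := re_trace_mul_conj_nonneg hA (Matrix.PosSemidef.one (n := n) (R := ℂ)) (G t y)
      rwa [Matrix.mul_one] at this)
    (by rw [← hw fun x => x * Real.log x, ← hv fun x => x * Real.log x, h])
  have hk := key 1 one_pos
  rw [hw fun x => (x + 1)⁻¹, hv fun x => (x + 1)⁻¹, hone, sub_self, Finset.sum_add_distrib] at hk
  have hG0 : G 1 x = 0 := by
    refine eq_zero_of_sum_re_trace_nonpos hA (G 1) (fun y => ?_) ?_ x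
    · have hc : suppProj A * cfc (fun x : ℝ => (x + 1)⁻¹) B
          = cfc (fun x : ℝ => (x + 1)⁻¹) B * suppProj A :=
        cfc_intertwine hB.1 hB.1 (hPB.trans hBP.symm) _
      simp only [G]
      rw [Matrix.sub_mul, Matrix.mul_assoc, hKP, Matrix.mul_assoc, ← hc, ← Matrix.mul_assoc, hKP]
    · have := Finset.sum_nonneg fun y (_ : y ∈ Finset.univ) =>
        re_trace_mul_conj_nonneg hA hX (G 1 y)
      simp only [one_mul] at hk
      linarith
  -- Multiply `(X + 1)⁻¹ Kᴴ = Kᴴ (B + 1)⁻¹` by `X + 1` on the left and by `B + 1` on the right.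
  have hG1 := sub_eq_zero.1 hG0
  set Q := cfc (fun x : ℝ => (x + 1)⁻¹) X
  set S := cfc (fun x : ℝ => (x + 1)⁻¹) B
  have hQ : X * Q = 1 - Q := by simpa using mul_cfc_resolvent hX one_pos
  have hS : S * B = 1 - S := by simpa using cfc_resolvent_mul hB one_pos
  have e1 : (X + 1) * Q = 1 := by rw [Matrix.add_mul, hQ]; simp
  have e2 : S * (B + 1) = 1 := by rw [Matrix.mul_add, hS]; simp
  have e3 : (K x)ᴴ * (B + 1) = (X + 1) * (K x)ᴴ := by
    calc (K x)ᴴ * (B + 1) = (X + 1) * (Q * (K x)ᴴ) * (B + 1) := by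
          rw [← Matrix.mul_assoc, e1, Matrix.one_mul]
      _ = (X + 1) * ((K x)ᴴ * (S * (B + 1))) := by rw [hG1]; simp only [Matrix.mul_assoc]
      _ = _ := by rw [e2, Matrix.mul_one]
  rw [Matrix.mul_add, Matrix.add_mul, Matrix.mul_one, Matrix.one_mul] at e3
  exact (add_right_cancel e3).symm

lemma trace_cfc_eq_of_intertwine {A B : Matrix m m ℂ} (hA : A.PosSemidef)
    (hX : X.IsHermitian) (hB : B.IsHermitian) (hP : ∑ x, K x * (K x)ᴴ = suppProj A)
    (h : ∀ x, X * (K x)ᴴ = (K x)ᴴ * B) (f : ℝ → ℝ) :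
    ((∑ x, (K x)ᴴ * A * K x) * cfc f X).trace = (A * cfc f B).trace := by
  have h1 : ∀ x, K x * cfc f X * (K x)ᴴ = K x * (K x)ᴴ * cfc f B := fun x => by
    rw [Matrix.mul_assoc, ← cfc_intertwine hB hX (h x).symm f, Matrix.mul_assoc]
  rw [trace_sum_conj_mul]
  simp only [h1]
  rw [← Matrix.sum_mul, hP, ← Matrix.mul_assoc, self_mul_suppProj hA]

end Jensen

/-! ### Channels in Kraus form -/

section Channel

variable {h k e : Type*} [Fintype h] [DecidableEq h] [Fintype k] [DecidableEq k]
  [Fintype e] [DecidableEq e]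

lemma suppProj_one : suppProj (1 : Matrix k k ℂ) = 1 := by
  simpa using suppProj_mul_self (Matrix.PosSemidef.one (n := k) (R := ℂ))

lemma suppProj_sum_mul (M : e → Matrix k h ℂ) (x : e) :
    suppProj (∑ y, M y * (M y)ᴴ) * M x = M x := by
  set A := ∑ y, M y * (M y)ᴴ with hA'
  have hA : A.PosSemidef := posSemidef_sum _ fun y _ => posSemidef_self_mul_conjTranspose (M y)
  have hG := eq_zero_of_sum_re_trace_nonpos (Matrix.PosSemidef.one (n := k) (R := ℂ))
    (fun y => (M y - suppProj A * M y)ᴴ) (fun y => by rw [suppProj_one, Matrix.mul_one]) (by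
      rw [← Complex.re_sum, ← Matrix.trace_sum, ← Matrix.mul_sum]
      have h1 : ∀ y, (M y - suppProj A * M y)ᴴᴴ * (M y - suppProj A * M y)ᴴ
          = (1 - suppProj A) * (M y * (M y)ᴴ) * (1 - suppProj A) := fun y => by
        simp only [conjTranspose_sub, conjTranspose_mul, conjTranspose_conjTranspose,
          (isHermitian_suppProj A).eq, Matrix.sub_mul, Matrix.mul_sub, Matrix.one_mul,
          Matrix.mul_one, Matrix.mul_assoc]
      simp only [h1]
      rw [← Matrix.sum_mul, ← Matrix.mul_sum, ← hA', Matrix.sub_mul, suppProj_mul_self hA]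
      simp) x
  exact (sub_eq_zero.1 (conjTranspose_eq_zero.1 hG)).symm

/-- The Kraus operators of `petzAdjoint T σ`, where `V` are the Kraus operators of `T`
and `A = T σ`. -/
noncomputable def petzKraus (V : e → Matrix k h ℂ) (A : Matrix k k ℂ) (σ : Matrix h h ℂ) (x : e) :
    Matrix k h ℂ :=
  minvSqrt A * V x * msqrt σ

variable {T : Matrix h h ℂ →ₗ[ℂ] Matrix k k ℂ} {V : e → Matrix k h ℂ} {ρ σ : Matrix h h ℂ}

lemma hsAdjoint_eq_sum (hT : ∀ X, T X = ∑ x, V x * X * (V x)ᴴ) (Y : Matrix k k ℂ) :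
    hsAdjoint T Y = ∑ x, (V x)ᴴ * Y * V x := by
  apply conjTranspose_injective
  refine Matrix.ext_iff_trace_mul_right.2 fun X => ?_
  rw [trace_hsAdjoint, hT, ← trace_sum_conj_mul, conjTranspose_sum]
  simp only [conjTranspose_mul, conjTranspose_conjTranspose, Matrix.mul_assoc]

lemma posSemidef_map (hT : ∀ X, T X = ∑ x, V x * X * (V x)ᴴ) (hσ : σ.PosSemidef) :
    (T σ).PosSemidef := by
  rw [hT]; exact posSemidef_sum_conj V hσ

lemma suppProj_map_mul (hT : ∀ X, T X = ∑ x, V x * X * (V x)ᴴ) (hσ : σ.PosSemidef) (x : e) :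
    suppProj (T σ) * (V x * msqrt σ) = V x * msqrt σ := by
  have h1 : T σ = ∑ y, (V y * msqrt σ) * (V y * msqrt σ)ᴴ := by
    rw [hT]
    refine Finset.sum_congr rfl fun y _ => ?_
    rw [conjTranspose_mul, (isHermitian_msqrt σ).eq, Matrix.mul_assoc (V y) (msqrt σ),
      msqrt_mul_msqrt_mul hσ, Matrix.mul_assoc]
  rw [h1]
  exact suppProj_sum_mul (fun y => V y * msqrt σ) x

lemma msqrt_mul_petzKraus (hT : ∀ X, T X = ∑ x, V x * X * (V x)ᴴ) (hσ : σ.PosSemidef) (x : e) :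
    msqrt (T σ) * petzKraus V (T σ) σ x = V x * msqrt σ := by
  rw [petzKraus, ← Matrix.mul_assoc, ← Matrix.mul_assoc, msqrt_mul_minvSqrt (posSemidef_map hT hσ),
    Matrix.mul_assoc, suppProj_map_mul hT hσ]

lemma sum_petzKraus (hT : ∀ X, T X = ∑ x, V x * X * (V x)ᴴ) (X : Matrix h h ℂ) :
    ∑ x, petzKraus V (T σ) σ x * X * (petzKraus V (T σ) σ x)ᴴ = petzAdjoint T σ X := by
  rw [petzAdjoint, hT (msqrt σ * X * msqrt σ), Matrix.mul_sum, Matrix.sum_mul]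
  refine Finset.sum_congr rfl fun x _ => ?_
  simp only [petzKraus, conjTranspose_mul, (isHermitian_msqrt σ).eq, (isHermitian_minvSqrt _).eq,
    Matrix.mul_assoc]

lemma sum_petzKraus_mul_conjTranspose (hT : ∀ X, T X = ∑ x, V x * X * (V x)ᴴ)
    (hσ : σ.PosSemidef) :
    ∑ x, petzKraus V (T σ) σ x * (petzKraus V (T σ) σ x)ᴴ = suppProj (T σ) := by
  have h1 := sum_petzKraus (σ := σ) hT 1
  simp only [Matrix.mul_one] at h1
  have hA := posSemidef_map hT hσ
  rw [h1, petzAdjoint, Matrix.mul_one, msqrt_mul_msqrt hσ]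
  nth_rewrite 2 [← msqrt_mul_msqrt hA]
  rw [← Matrix.mul_assoc, minvSqrt_mul_msqrt hA, suppProj_mul_msqrt, msqrt_mul_minvSqrt hA]

lemma petzKraus_conjTranspose_mul_suppProj (x : e) :
    (petzKraus V (T σ) σ x)ᴴ * suppProj (T σ) = (petzKraus V (T σ) σ x)ᴴ := by
  have h1 : suppProj (T σ) * petzKraus V (T σ) σ x = petzKraus V (T σ) σ x := by
    rw [petzKraus, ← Matrix.mul_assoc, ← Matrix.mul_assoc, suppProj_mul_minvSqrt]
  have h2 := congrArg conjTranspose h1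
  rwa [conjTranspose_mul, (isHermitian_suppProj _).eq] at h2

lemma sum_conjTranspose_petzKraus_mul (hT : ∀ X, T X = ∑ x, V x * X * (V x)ᴴ)
    (hV : ∑ x, (V x)ᴴ * V x = 1) (hσ : σ.PosSemidef) :
    ∑ x, (petzKraus V (T σ) σ x)ᴴ * T σ * petzKraus V (T σ) σ x = σ := by
  have h1 : ∀ x, (petzKraus V (T σ) σ x)ᴴ * T σ * petzKraus V (T σ) σ x
      = msqrt σ * ((V x)ᴴ * V x) * msqrt σ := fun x => by
    have h2 : (petzKraus V (T σ) σ x)ᴴ * T σ * petzKraus V (T σ) σ x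
        = (msqrt (T σ) * petzKraus V (T σ) σ x)ᴴ * (msqrt (T σ) * petzKraus V (T σ) σ x) := by
      rw [conjTranspose_mul, (isHermitian_msqrt _).eq,
        Matrix.mul_assoc (petzKraus V (T σ) σ x)ᴴ (msqrt (T σ)),
        msqrt_mul_msqrt_mul (posSemidef_map hT hσ), Matrix.mul_assoc]
    rw [h2, msqrt_mul_petzKraus hT hσ, conjTranspose_mul, (isHermitian_msqrt _).eq]
    simp only [Matrix.mul_assoc]
  simp only [h1]
  rw [← Matrix.sum_mul, ← Matrix.mul_sum, hV, Matrix.mul_one, msqrt_mul_msqrt hσ]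

lemma petzAdjoint_quot (hρ : ρ.PosSemidef) (hσ : σ.PosSemidef) (hPρ : suppProj σ * ρ = ρ) :
    petzAdjoint T σ (quot ρ σ) = quot (T ρ) (T σ) := by
  rw [petzAdjoint, msqrt_mul_quot_mul_msqrt hσ hPρ
    (mul_eq_of_conjTranspose (isHermitian_suppProj σ) hρ.1 hPρ), quot]

lemma suppProj_map_mul_map (hT : ∀ X, T X = ∑ x, V x * X * (V x)ᴴ) (hρ : ρ.PosSemidef)
    (hσ : σ.PosSemidef) (hPρ : suppProj σ * ρ = ρ) : suppProj (T σ) * T ρ = T ρ := by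
  have hX := msqrt_mul_quot_mul_msqrt hσ hPρ
    (mul_eq_of_conjTranspose (isHermitian_suppProj σ) hρ.1 hPρ)
  rw [hT ρ, Matrix.mul_sum]
  refine Finset.sum_congr rfl fun x _ => ?_
  rw [← hX, Matrix.mul_assoc (msqrt σ), ← Matrix.mul_assoc (V x), Matrix.mul_assoc _ _ (V x)ᴴ,
    ← Matrix.mul_assoc, suppProj_map_mul hT hσ]

/-- The adjoints of the Kraus operators of `petzAdjoint T σ` intertwine `[ρ/σ]` and `[T ρ/T σ]`.
This is the common content of all the equality conditions. -/
def KrausIntertwines (T : Matrix h h ℂ →ₗ[ℂ] Matrix k k ℂ) (V : e → Matrix k h ℂ)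
    (ρ σ : Matrix h h ℂ) : Prop :=
  ∀ x, quot ρ σ * (petzKraus V (T σ) σ x)ᴴ = (petzKraus V (T σ) σ x)ᴴ * quot (T ρ) (T σ)

lemma suppProj_mul_quot (R A : Matrix h h ℂ) : suppProj A * quot R A = quot R A := by
  rw [quot, ← Matrix.mul_assoc, ← Matrix.mul_assoc, suppProj_mul_minvSqrt]

theorem petzAdjoint_sq_iff (hT : ∀ X, T X = ∑ x, V x * X * (V x)ᴴ) (hρ : ρ.PosSemidef)
    (hσ : σ.PosSemidef) (hPρ : suppProj σ * ρ = ρ) :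
    petzAdjoint T σ (quot ρ σ ^ 2) = (petzAdjoint T σ (quot ρ σ)) ^ 2
      ↔ KrausIntertwines T V ρ σ := by
  have hX : (quot ρ σ).PosSemidef := posSemidef_quot hρ
  have hB : (quot (T ρ) (T σ)).PosSemidef := posSemidef_quot (posSemidef_map hT hρ)
  have hBX : ∑ x, petzKraus V (T σ) σ x * quot ρ σ * (petzKraus V (T σ) σ x)ᴴ
      = quot (T ρ) (T σ) := by rw [sum_petzKraus hT, petzAdjoint_quot hρ hσ hPρ]
  rw [petzAdjoint_quot hρ hσ hPρ, ← sum_petzKraus hT]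
  refine ⟨fun h x => ?_, fun h => ?_⟩
  · exact intertwine_of_trace_sq_eq _ _ (posSemidef_map hT hσ) hX.1 hB.1
      (sum_petzKraus_mul_conjTranspose hT hσ) petzKraus_conjTranspose_mul_suppProj hBX
      (suppProj_mul_quot _ _) (by rw [h]) x
  · exact sum_conj_sq_eq_of_intertwine _ _ hX.1 hB.1 (sum_petzKraus_mul_conjTranspose hT hσ) hBX
      (suppProj_mul_quot _ _) h

lemma bsEntropy_eq (hρ : ρ.PosSemidef) (hσ : σ.PosSemidef) (hPρ : suppProj σ * ρ = ρ) :
    bsEntropy ρ σ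
      = (((σ * cfc (fun x => x * Real.log x) (quot ρ σ)).trace.re : ℝ) : EReal) := by
  rw [bsEntropy, if_pos (ker_le_of_mul_suppProj hσ
    (mul_eq_of_conjTranspose (isHermitian_suppProj σ) hρ.1 hPρ)), trace_entropy_eq hρ hσ hPρ]

theorem bsEntropy_eq_iff (hT : ∀ X, T X = ∑ x, V x * X * (V x)ᴴ) (hV : ∑ x, (V x)ᴴ * V x = 1)
    (hρ : ρ.PosSemidef) (hσ : σ.PosSemidef) (hPρ : suppProj σ * ρ = ρ) :
    bsEntropy ρ σ = bsEntropy (T ρ) (T σ) ↔ KrausIntertwines T V ρ σ := by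
  have hX : (quot ρ σ).PosSemidef := posSemidef_quot hρ
  have hA := posSemidef_map hT hσ
  have hB : (quot (T ρ) (T σ)).PosSemidef := posSemidef_quot (posSemidef_map hT hρ)
  have hBX : ∑ x, petzKraus V (T σ) σ x * quot ρ σ * (petzKraus V (T σ) σ x)ᴴ
      = quot (T ρ) (T σ) := by rw [sum_petzKraus hT, petzAdjoint_quot hρ hσ hPρ]
  have hM := sum_conjTranspose_petzKraus_mul hT hV hσ
  rw [bsEntropy_eq hρ hσ hPρ, bsEntropy_eq (posSemidef_map hT hρ) hA
    (suppProj_map_mul_map hT hρ hσ hPρ), EReal.coe_eq_coe_iff]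
  refine ⟨fun h x => ?_, fun h => ?_⟩
  · exact intertwine_of_trace_entropy_eq _ _ hA hX
      (sum_petzKraus_mul_conjTranspose hT hσ) petzKraus_conjTranspose_mul_suppProj hBX
      (suppProj_mul_quot _ _) (by rw [hM, h]) x
  · have := trace_cfc_eq_of_intertwine _ _ hA hX.1 hB.1 (sum_petzKraus_mul_conjTranspose hT hσ) h
      (fun x => x * Real.log x)
    rw [hM] at this
    rw [this]

lemma trace_mul_quot_sq {R A : Matrix h h ℂ} (hA : A.PosSemidef) (hR : suppProj A * R = R) :
    (A * quot R A ^ 2).trace = (R * minv A * R).trace := by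
  have h1 : minvSqrt A * A * minvSqrt A = suppProj A := by
    nth_rewrite 2 [← msqrt_mul_msqrt hA]
    rw [← Matrix.mul_assoc, minvSqrt_mul_msqrt hA, suppProj_mul_msqrt, msqrt_mul_minvSqrt hA]
  have h2 : A * quot R A ^ 2
      = A * minvSqrt A * R * (minvSqrt A * minvSqrt A) * R * minvSqrt A := by
    simp only [quot, pow_two, Matrix.mul_assoc]
  rw [h2, Matrix.trace_mul_comm, minvSqrt_mul_minvSqrt hA]
  simp only [← Matrix.mul_assoc]
  rw [h1, hR]

lemma minv_mul_eq_quot {R A : Matrix h h ℂ} (hA : A.PosSemidef) (hR' : R * suppProj A = R) :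
    minv A * R = minvSqrt A * quot R A * msqrt A := by
  calc minv A * R = minvSqrt A * (minvSqrt A * R * suppProj A) := by
        rw [← minvSqrt_mul_minvSqrt hA, Matrix.mul_assoc (minvSqrt A) R, hR', Matrix.mul_assoc]
    _ = _ := by rw [← minvSqrt_mul_msqrt hA, quot]; simp only [Matrix.mul_assoc]

/-- The recovery condition gives `tr[ρ σ⁻¹ ρ] = tr[T ρ (T σ)⁻¹ T ρ]`, which is the equality of the
traces of the two sides of `T_σ([ρ/σ]²) = T_σ([ρ/σ])²` against `T σ`. -/
theorem recovery_iff (hT : ∀ X, T X = ∑ x, V x * X * (V x)ᴴ) (hV : ∑ x, (V x)ᴴ * V x = 1)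
    (hρ : ρ.PosSemidef) (hσ : σ.PosSemidef) (hPρ : suppProj σ * ρ = ρ) :
    ρ = σ * hsAdjoint T (minv (T σ) * T ρ) ↔ KrausIntertwines T V ρ σ := by
  have hρP := mul_eq_of_conjTranspose (isHermitian_suppProj σ) hρ.1 hPρ
  have hX : (quot ρ σ).PosSemidef := posSemidef_quot hρ
  have hA := posSemidef_map hT hσ
  have hB : (quot (T ρ) (T σ)).PosSemidef := posSemidef_quot (posSemidef_map hT hρ)
  have hBX : ∑ x, petzKraus V (T σ) σ x * quot ρ σ * (petzKraus V (T σ) σ x)ᴴ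
      = quot (T ρ) (T σ) := by rw [sum_petzKraus hT, petzAdjoint_quot hρ hσ hPρ]
  have hPT := suppProj_map_mul_map hT hρ hσ hPρ
  have hTP := mul_eq_of_conjTranspose (isHermitian_suppProj _) (posSemidef_map hT hρ).1 hPT
  constructor
  · intro hrec x
    refine intertwine_of_trace_sq_eq _ _ hA hX.1 hB.1
      (sum_petzKraus_mul_conjTranspose hT hσ) petzKraus_conjTranspose_mul_suppProj hBX
      (suppProj_mul_quot _ _) ?_ x
    rw [← trace_sum_conj_mul, sum_conjTranspose_petzKraus_mul hT hV hσ,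
      trace_mul_quot_sq hσ hPρ, trace_mul_quot_sq hA hPT]
    set Y := minv (T σ) * T ρ with hY
    have h1 : ρ * minv σ * ρ = ρ * hsAdjoint T Y := by
      nth_rewrite 2 [hrec]
      rw [Matrix.mul_assoc, ← Matrix.mul_assoc (minv σ), minv_mul_self hσ, ← Matrix.mul_assoc, hρP]
    rw [h1, Matrix.mul_assoc, ← hY, hsAdjoint_eq_sum hT, Matrix.trace_mul_comm, trace_sum_conj_mul,
      ← hT, Matrix.trace_mul_comm]
  · intro hint
    rw [hsAdjoint_eq_sum hT, minv_mul_eq_quot hA hTP, Matrix.mul_sum]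
    have h1 : ∀ x, σ * ((V x)ᴴ * (minvSqrt (T σ) * quot (T ρ) (T σ) * msqrt (T σ)) * V x)
        = ρ * ((V x)ᴴ * V x) := by
      intro x
      have e1 : σ * ((V x)ᴴ * (minvSqrt (T σ) * quot (T ρ) (T σ) * msqrt (T σ)) * V x)
          = msqrt σ * ((petzKraus V (T σ) σ x)ᴴ * quot (T ρ) (T σ)) * (msqrt (T σ) * V x) := by
        simp only [petzKraus, conjTranspose_mul, (isHermitian_msqrt _).eq,
          (isHermitian_minvSqrt _).eq, Matrix.mul_assoc, msqrt_mul_msqrt_mul hσ]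
      have e2 : (petzKraus V (T σ) σ x)ᴴ * msqrt (T σ) = msqrt σ * (V x)ᴴ := by
        have := congrArg conjTranspose (msqrt_mul_petzKraus hT hσ x)
        rwa [conjTranspose_mul, conjTranspose_mul, (isHermitian_msqrt _).eq,
          (isHermitian_msqrt _).eq] at this
      rw [e1, ← hint x]
      calc _ = msqrt σ * quot ρ σ * ((petzKraus V (T σ) σ x)ᴴ * msqrt (T σ)) * V x := by
            simp only [Matrix.mul_assoc]
        _ = msqrt σ * quot ρ σ * msqrt σ * ((V x)ᴴ * V x) := by
            rw [e2]; simp only [Matrix.mul_assoc]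
        _ = _ := by rw [msqrt_mul_quot_mul_msqrt hσ hPρ hρP]
    simp only [h1]
    rw [← Matrix.mul_sum, hV, Matrix.mul_one]

end Channel

/-! ### Operators on a tensor product -/

section Tensor

variable {h k e l : Type*} [Fintype h] [DecidableEq h] [Fintype k] [DecidableEq k]
  [Fintype e] [DecidableEq e] [Fintype l] [DecidableEq l]

/-- The block `(I ⊗ ⟨x|) Y` of an operator `Y` into `K ⊗ H_E`. The blocks of an isometry `U` are
the Kraus operators of the channel `X ↦ tr_E[U X Uᴴ]`. -/
def krausOp (Y : Matrix (k × e) h ℂ) (x : e) : Matrix k h ℂ := Y.submatrix (fun i => (i, x)) id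

lemma krausOp_ext {Y Z : Matrix (k × e) h ℂ} (H : ∀ x, krausOp Y x = krausOp Z x) : Y = Z := by
  ext ⟨i, x⟩ j
  exact congrFun (congrFun (H x) i) j

lemma krausOp_mul (Y : Matrix (k × e) h ℂ) (N : Matrix h l ℂ) (x : e) :
    krausOp (Y * N) x = krausOp Y x * N := by
  ext i j
  simp [krausOp, Matrix.mul_apply]

lemma krausOp_tensorId_mul (M : Matrix l k ℂ) (Y : Matrix (k × e) h ℂ) (x : e) :
    krausOp (tensorId e M * Y) x = M * krausOp Y x := by
  ext i j
  simp [krausOp, Matrix.mul_apply, tensorId, Fintype.sum_prod_type, Matrix.one_apply]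

lemma tensorId_mul_tensorId {m n : Type*} (M : Matrix m k ℂ) (N : Matrix k n ℂ) :
    tensorId e M * tensorId e N = tensorId e (M * N) := by
  simp [tensorId, ← Matrix.mul_kronecker_mul]

lemma conjTranspose_tensorId {m n : Type*} (M : Matrix m n ℂ) :
    (tensorId e M)ᴴ = tensorId e Mᴴ := by
  simp [tensorId, Matrix.conjTranspose_kronecker]

lemma trE_eq_sum_krausOp (Y Z : Matrix (k × e) h ℂ) :
    trE (Y * Zᴴ) = ∑ x, krausOp Y x * (krausOp Z x)ᴴ := by
  ext i j
  simp [trE, krausOp, Matrix.mul_apply, Matrix.sum_apply]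

lemma trE_tensorId_mul (M : Matrix l k ℂ) (Y : Matrix (k × e) (k × e) ℂ) (N : Matrix k l ℂ) :
    trE (tensorId e M * Y * tensorId e N) = M * trE Y * N := by
  ext i j
  simp only [trE, Matrix.of_apply, Matrix.mul_apply, tensorId, Fintype.sum_prod_type,
    kroneckerMap_apply, Matrix.one_apply, mul_ite, mul_one, mul_zero, ite_mul, zero_mul,
    Finset.sum_ite_eq, Finset.sum_ite_eq', Finset.mem_univ, if_true, Finset.sum_mul,
    Finset.mul_sum]
  rw [Finset.sum_comm]
  refine Finset.sum_congr rfl fun b _ => ?_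
  rw [Finset.sum_comm]

lemma conjTranspose_mul_tensorId_mul (U : Matrix (k × e) h ℂ) (Y : Matrix k k ℂ) :
    Uᴴ * tensorId e Y * U = ∑ x, (krausOp U x)ᴴ * Y * krausOp U x := by
  ext i j
  rw [Matrix.mul_assoc, Matrix.mul_apply, Fintype.sum_prod_type, Finset.sum_comm,
    Matrix.sum_apply]
  refine Finset.sum_congr rfl fun x _ => ?_
  rw [Matrix.mul_assoc, ← krausOp_tensorId_mul]
  simp [krausOp, Matrix.mul_apply]

lemma sum_krausOp_conjTranspose_mul {U : Matrix (k × e) h ℂ} (hU : Uᴴ * U = 1) :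
    ∑ x, (krausOp U x)ᴴ * krausOp U x = 1 := by
  have h1 := conjTranspose_mul_tensorId_mul U 1
  simp only [Matrix.mul_one] at h1
  rw [← h1, tensorId, Matrix.one_kronecker_one, Matrix.mul_one, hU]

lemma trE_isometry (U : Matrix (k × e) h ℂ) (X : Matrix h h ℂ) :
    trE (U * X * Uᴴ) = ∑ x, krausOp U x * X * (krausOp U x)ᴴ := by
  rw [trE_eq_sum_krausOp]
  simp only [krausOp_mul]

end Tensor

/-! ### The block decomposition -/

section Block

variable {h k e : Type*} [Fintype h] [DecidableEq h] [Fintype k] [DecidableEq k]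
  [Fintype e] [DecidableEq e]

lemma blockSum_eq_tensorId_mul {N : ℕ} {dL dR : Fin N → ℕ}
    (A : ∀ n, Matrix (Fin (dL n)) (Fin (dL n)) ℂ)
    (B : ∀ n, Matrix (Fin (dR n) × e) (Fin (dR n) × e) ℂ) :
    blockSum A B = tensorId e (Matrix.blockDiagonal' fun n =>
      A n ⊗ₖ (1 : Matrix (Fin (dR n)) (Fin (dR n)) ℂ)) * blockSum (fun _ => 1) B := by
  refine krausOp_ext fun x => ?_
  rw [krausOp_tensorId_mul]
  ext ⟨n, a, b⟩ ⟨⟨n', a', b'⟩, y⟩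
  simp only [krausOp, blockSum, Matrix.submatrix_apply, id, Matrix.mul_apply,
    Fintype.sum_sigma, Matrix.blockDiagonal'_apply]
  rw [Finset.sum_eq_single n]
  · by_cases hn : n = n'
    · subst hn
      simp [Fintype.sum_prod_type, Matrix.one_apply]
    · simp [hn]
  · intro m _ hm
    simp [Ne.symm hm]
  · simp

/-- With `C = T(σ)^{1/2} Sᴴ (⨁ η^L ⊗ I) S T(σ)^{-1/2}` the block forms read `ρ₀ = (C ⊗ I) σ₀`, and
`Cᴴ = T(σ)⁻¹ T(ρ)`; both use `tr_E ⨁ I ⊗ η^R = I`, which follows from `T(σ) = tr_E σ₀`. -/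
theorem recovery_of_hasBlockDecomposition {T : Matrix h h ℂ →ₗ[ℂ] Matrix k k ℂ}
    {U : Matrix (k × e) h ℂ} {ρ σ : Matrix h h ℂ} (hU : Uᴴ * U = 1)
    (hT : ∀ X, T X = trE (U * X * Uᴴ)) (hρ : ρ.PosSemidef) (hσ : σ.PosSemidef)
    (H : HasBlockDecomposition U (T σ) ρ σ) :
    ρ = σ * hsAdjoint T (minv (T σ) * T ρ) := by
  obtain ⟨N, dL, dR, S, ρ₀, σ₀, ηL, ηR, hS1, hS2, hρ0, hσ0, hsρ, hsσ, hUρ, hUσ, hL, hR, hρe, hσe⟩ :=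
    H
  have hT' : ∀ X, T X = ∑ x, krausOp U x * X * (krausOp U x)ᴴ := fun X => by
    rw [hT, trE_isometry]
  have hA := posSemidef_map hT' hσ
  set A := T σ with hAdef
  have hE : (U * Uᴴ) * (U * Uᴴ) = U * Uᴴ := by
    rw [Matrix.mul_assoc, ← Matrix.mul_assoc Uᴴ, hU, Matrix.one_mul]
  have hEh : (U * Uᴴ).IsHermitian := isHermitian_mul_conjTranspose_self U
  have hback : ∀ R : Matrix (k × e) (k × e) ℂ, R.PosSemidef → supp R ≤ supp (U * Uᴴ) →
      U * (Uᴴ * R * U) * Uᴴ = R := fun R hR0 hR => by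
    have h1 := mul_eq_of_supp_le hE hR
    have h2 := mul_eq_of_conjTranspose hEh hR0.1 h1
    calc U * (Uᴴ * R * U) * Uᴴ = (U * Uᴴ * R) * (U * Uᴴ) := by simp only [Matrix.mul_assoc]
      _ = R := by rw [h1, h2]
  have hρ' : U * ρ * Uᴴ = ρ₀ := by rw [hUρ, hback _ hρ0 hsρ]
  have hσ' : U * σ * Uᴴ = σ₀ := by rw [hUσ, hback _ hσ0 hsσ]
  set Z := blockSum (dL := dL) (fun _ => 1) ηR
  set L := Matrix.blockDiagonal' fun n => ηL n ⊗ₖ (1 : Matrix (Fin (dR n)) (Fin (dR n)) ℂ)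
    with hLdef
  have hLh : Lᴴ = L := by
    rw [hLdef, Matrix.blockDiagonal'_conjTranspose]
    congr 1; ext1 n
    rw [conjTranspose_kronecker, conjTranspose_one, (hL n).1.eq]
  rw [blockSum_eq_tensorId_mul, ← Matrix.mul_assoc, tensorId_mul_tensorId] at hρe
  have hSP : S * suppProj A = S := by rw [← hS2, ← Matrix.mul_assoc, hS1, Matrix.one_mul]
  have hPS : suppProj A * Sᴴ = Sᴴ := by rw [← hS2, Matrix.mul_assoc, hS1, Matrix.mul_one]
  have hAe : A = msqrt A * Sᴴ * trE Z * (S * msqrt A) := by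
    conv_lhs => rw [hAdef, hT, hσ', hσe]
    rw [trE_tensorId_mul]
  have htr : trE Z = 1 := by
    have h1 : suppProj A = Sᴴ * trE Z * S := by
      have h2 : minvSqrt A * A * minvSqrt A = suppProj A := by
        nth_rewrite 2 [← msqrt_mul_msqrt hA]
        rw [← Matrix.mul_assoc, minvSqrt_mul_msqrt hA, suppProj_mul_msqrt, msqrt_mul_minvSqrt hA]
      calc suppProj A = minvSqrt A * (msqrt A * Sᴴ * trE Z * (S * msqrt A)) * minvSqrt A := by
            rw [← hAe, h2]
        _ = (minvSqrt A * msqrt A * Sᴴ) * trE Z * (S * (msqrt A * minvSqrt A)) := by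
            simp only [Matrix.mul_assoc]
        _ = _ := by rw [minvSqrt_mul_msqrt hA, msqrt_mul_minvSqrt hA, hPS, hSP]
    calc trE Z = (S * Sᴴ) * trE Z * (S * Sᴴ) := by rw [hS1, Matrix.one_mul, Matrix.mul_one]
      _ = S * (Sᴴ * trE Z * S) * Sᴴ := by simp only [Matrix.mul_assoc]
      _ = 1 := by rw [← h1, hSP, hS1]
  have hTρ : minv A * T ρ = minvSqrt A * Sᴴ * L * S * msqrt A := by
    have h1 : T ρ = msqrt A * Sᴴ * L * (S * msqrt A) := by
      rw [hT, hρ', hρe, trE_tensorId_mul, htr, Matrix.mul_one]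
    have h2 : minv A * msqrt A = minvSqrt A := by
      rw [← minvSqrt_mul_minvSqrt hA, Matrix.mul_assoc, minvSqrt_mul_msqrt hA,
        minvSqrt_mul_suppProj]
    rw [h1]
    simp only [← Matrix.mul_assoc]
    rw [h2]
  have hC : ρ₀ = tensorId e (minv A * T ρ)ᴴ * σ₀ := by
    have h1 : (minv A * T ρ)ᴴ * (msqrt A * Sᴴ) = msqrt A * Sᴴ * L := by
      rw [hTρ]
      simp only [conjTranspose_mul, conjTranspose_conjTranspose, (isHermitian_msqrt A).eq,
        (isHermitian_minvSqrt A).eq, hLh]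
      calc _ = msqrt A * Sᴴ * L * (S * (minvSqrt A * msqrt A) * Sᴴ) := by
            simp only [Matrix.mul_assoc]
        _ = _ := by rw [minvSqrt_mul_msqrt hA, hSP, hS1, Matrix.mul_one]
    rw [hρe, hσe, ← Matrix.mul_assoc, ← Matrix.mul_assoc, tensorId_mul_tensorId, h1]
  have hfin : ρ = Uᴴ * tensorId e (minv A * T ρ)ᴴ * U * σ := by
    calc ρ = Uᴴ * (U * ρ * Uᴴ) * U := by rw [hρ', hUρ]
      _ = Uᴴ * tensorId e (minv A * T ρ)ᴴ * (U * σ * Uᴴ) * U := by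
        rw [hρ', hC, hσ']; simp only [Matrix.mul_assoc]
      _ = Uᴴ * tensorId e (minv A * T ρ)ᴴ * U * σ * (Uᴴ * U) := by simp only [Matrix.mul_assoc]
      _ = _ := by rw [hU, Matrix.mul_one]
  have hadj := congrArg conjTranspose hfin
  simp only [conjTranspose_mul, conjTranspose_conjTranspose, conjTranspose_tensorId, hρ.1.eq,
    hσ.1.eq] at hadj
  rw [hsAdjoint_eq_sum hT', ← conjTranspose_mul_tensorId_mul]
  refine hadj.trans ?_
  simp only [Matrix.mul_assoc]

end Block

/-! ### Decomposition into eigenspaces -/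

section Spectral

variable {h k e : Type*} [Fintype h] [DecidableEq h] [Fintype k] [DecidableEq k]
  [Fintype e] [DecidableEq e]

/-- A finite family of nonnegative reals, grouped by its values. Grouping all indices of the same
value is what makes `b` injective. -/
lemma exists_blockIndex_equiv {ι : Type*} [Fintype ι] (d : ι → ℝ) (hd : ∀ i, 0 ≤ d i) :
    ∃ (N : ℕ) (dR : Fin N → ℕ) (b : Fin N → ℝ) (E : BlockIndex (fun _ : Fin N => 1) dR ≃ ι),
      Function.Injective b ∧ (∀ n, 0 ≤ b n) ∧ ∀ p, d (E p) = b p.1 := by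
  classical
  let F := Set.range d
  let e₀ : F ≃ Fin (Fintype.card F) := Fintype.equivFin F
  let f : ι → Fin (Fintype.card F) := fun i => e₀ ⟨d i, i, rfl⟩
  let dR : Fin (Fintype.card F) → ℕ := fun n => Fintype.card {i // f i = n}
  let E : BlockIndex (fun _ : Fin (Fintype.card F) => 1) dR ≃ ι :=
    (Equiv.sigmaCongrRight fun n =>
      (Equiv.uniqueProd (Fin (dR n)) (Fin 1)).trans (Fintype.equivFin {i // f i = n}).symm).trans
      (Equiv.sigmaFiberEquiv f)
  refine ⟨Fintype.card F, dR, fun n => (e₀.symm n).1, E,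
    fun a b hab => e₀.symm.injective (Subtype.ext hab), fun n => ?_, fun p => ?_⟩
  · obtain ⟨i, hi⟩ := (e₀.symm n).2
    exact (hd i).trans_eq hi
  · have h1 : f (E p) = p.1 :=
      ((Fintype.equivFin {i // f i = p.1}).symm (p.2.2)).2
    rw [← h1]
    simp [f]

lemma exists_unitary_diagonal {A : Matrix k k ℂ} (hA : A.IsHermitian) :
    ∃ (Q : Matrix k k ℂ) (d : k → ℝ), Qᴴ * Q = 1 ∧ Q * Qᴴ = 1 ∧
      A = Q * (diagonal fun i => (d i : ℂ)) * Qᴴ := by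
  refine ⟨hA.eigenvectorUnitary, hA.eigenvalues, Unitary.coe_star_mul_self _,
    Unitary.coe_mul_star_self _, ?_⟩
  conv_lhs => rw [hA.spectral_theorem, Unitary.conjStarAlgAut_apply]
  rfl

/-- A unitary from the range of a projection `P`, extended by zero. -/
lemma exists_coisometry_of_projection {P : Matrix k k ℂ} (hP : P.IsHermitian) (hPP : P * P = P) :
    ∃ (p : k → Prop) (_ : Fintype {i // p i}) (S : Matrix {i // p i} k ℂ),
      S * Sᴴ = 1 ∧ Sᴴ * S = P := by
  classical
  obtain ⟨Q, d, hQ1, hQ2, hspec⟩ := exists_unitary_diagonal hP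
  set D : Matrix k k ℂ := diagonal fun i => (d i : ℂ) with hD
  have hDP : D = Qᴴ * P * Q := by
    calc D = (Qᴴ * Q) * D * (Qᴴ * Q) := by rw [hQ1, Matrix.one_mul, Matrix.mul_one]
      _ = Qᴴ * (Q * D * Qᴴ) * Q := by simp only [Matrix.mul_assoc]
      _ = _ := by rw [← hspec]
  have hDD : D * D = D := by
    calc D * D = Qᴴ * P * (Q * Qᴴ) * P * Q := by rw [hDP]; simp only [Matrix.mul_assoc]
      _ = Qᴴ * (P * P) * Q := by rw [hQ2, Matrix.mul_one]; simp only [Matrix.mul_assoc]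
      _ = D := by rw [hPP, ← hDP]
  have hev : ∀ i, d i ≠ 0 → d i = 1 := by
    intro i hi
    rw [hD, diagonal_mul_diagonal, diagonal_eq_diagonal_iff] at hDD
    have h1 := hDD i
    have h2 : d i * d i = d i := by exact_mod_cast h1
    exact mul_left_cancel₀ hi (by rw [h2, mul_one])
  refine ⟨fun i => d i ≠ 0, inferInstance, Qᴴ.submatrix Subtype.val id, ?_, ?_⟩
  · rw [conjTranspose_submatrix, conjTranspose_conjTranspose,
      ← Matrix.submatrix_mul _ _ _ _ _ Function.bijective_id, hQ1,
      Matrix.submatrix_one _ Subtype.val_injective]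
  · conv_rhs => rw [hspec]
    ext a c
    rw [conjTranspose_submatrix, conjTranspose_conjTranspose]
    rw [hD, Matrix.mul_apply, Matrix.mul_apply]
    simp only [Matrix.submatrix_apply, id, Matrix.mul_diagonal]
    rw [← Finset.sum_subtype (Finset.univ.filter fun i => d i ≠ 0) (by simp)
      (fun i => Q a i * Qᴴ i c), Finset.sum_filter]
    refine Finset.sum_congr rfl fun i _ => ?_
    by_cases hi : d i = 0
    · simp [hi]
    · simp [hev i hi]

/-- Diagonalization of a positive operator on the range of a projection, with the basis grouped
into eigenspaces. -/
lemma exists_blockIndex_diagonalization {P B : Matrix k k ℂ} (hP : P.IsHermitian)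
    (hPP : P * P = P) (hB : B.PosSemidef) :
    ∃ (N : ℕ) (dR : Fin N → ℕ) (b : Fin N → ℝ)
      (S : Matrix (BlockIndex (fun _ : Fin N => 1) dR) k ℂ),
      Function.Injective b ∧ (∀ n, 0 ≤ b n) ∧ S * Sᴴ = 1 ∧ Sᴴ * S = P ∧
      S * B * Sᴴ = diagonal fun p => (b p.1 : ℂ) := by
  classical
  obtain ⟨p, _, S₀, h1, h2⟩ := exists_coisometry_of_projection hP hPP
  have hB' : (S₀ * B * S₀ᴴ).PosSemidef := hB.mul_mul_conjTranspose_same S₀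
  obtain ⟨Q, d, hQ1, hQ2, hspec⟩ := exists_unitary_diagonal hB'.1
  have h3 : (Qᴴ * S₀) * B * (Qᴴ * S₀)ᴴ = diagonal fun i => (d i : ℂ) := by
    calc (Qᴴ * S₀) * B * (Qᴴ * S₀)ᴴ = Qᴴ * (S₀ * B * S₀ᴴ) * Q := by
          rw [conjTranspose_mul, conjTranspose_conjTranspose]; simp only [Matrix.mul_assoc]
      _ = (Qᴴ * Q) * (diagonal fun i => (d i : ℂ)) * (Qᴴ * Q) := by
          rw [hspec]; simp only [Matrix.mul_assoc]
      _ = _ := by rw [hQ1, Matrix.one_mul, Matrix.mul_one]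
  have hd : ∀ i, 0 ≤ d i := fun i => by
    have := hB.mul_mul_conjTranspose_same (Qᴴ * S₀)
    rw [h3, posSemidef_diagonal_iff] at this
    exact Complex.zero_le_real.1 (this i)
  obtain ⟨N, dR, b, E, hb, hb0, hE⟩ := exists_blockIndex_equiv d hd
  refine ⟨N, dR, b, (Qᴴ * S₀).submatrix E id, hb, hb0, ?_, ?_, ?_⟩
  · rw [conjTranspose_submatrix, ← Matrix.submatrix_mul _ _ _ _ _ Function.bijective_id,
      conjTranspose_mul, conjTranspose_conjTranspose, Matrix.mul_assoc, ← Matrix.mul_assoc S₀, h1,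
      Matrix.one_mul, hQ1, Matrix.submatrix_one_equiv]
  · rw [conjTranspose_submatrix, Matrix.submatrix_mul_equiv, Matrix.submatrix_id_id,
      conjTranspose_mul, conjTranspose_conjTranspose, Matrix.mul_assoc, ← Matrix.mul_assoc Q, hQ2,
      Matrix.one_mul, h2]
  · have h4 : (Qᴴ * S₀).submatrix E id * B * ((Qᴴ * S₀).submatrix E id)ᴴ
        = ((Qᴴ * S₀) * B * (Qᴴ * S₀)ᴴ).submatrix E E := rfl
    rw [h4, h3, Matrix.submatrix_diagonal_equiv]
    congr 1; ext q
    simp [hE]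

/-- An operator commuting with `D ⊗ I`, where `D` is diagonal with distinct values on distinct
blocks, is block diagonal. -/
lemma blockSum_of_commute {N : ℕ} {dR : Fin N → ℕ} {b : Fin N → ℝ} (hb : Function.Injective b)
    (M : Matrix (BlockIndex (fun _ : Fin N => 1) dR × e) (BlockIndex (fun _ : Fin N => 1) dR × e) ℂ)
    (hM : tensorId e (diagonal fun p => (b p.1 : ℂ)) * M
      = M * tensorId e (diagonal fun p => (b p.1 : ℂ))) :
    blockSum (dL := fun _ : Fin N => 1) (fun _ => 1)
      (fun n => M.submatrix (fun i => (⟨n, (0, i.1)⟩, i.2)) fun i => (⟨n, (0, i.1)⟩, i.2)) = M := by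
  have hD : tensorId e (diagonal fun p : BlockIndex (fun _ : Fin N => 1) dR => (b p.1 : ℂ))
      = diagonal fun p => (b p.1.1 : ℂ) := by
    rw [tensorId, ← diagonal_one, diagonal_kronecker_diagonal]
    simp
  rw [hD] at hM
  ext ⟨⟨n, a, r⟩, x⟩ ⟨⟨n', a', r'⟩, x'⟩
  by_cases hn : n = n'
  · subst hn
    simp [blockSum, Matrix.blockDiagonal'_apply, Subsingleton.elim a 0, Subsingleton.elim a' 0]
  · have h1 := congrFun (congrFun hM (⟨n, a, r⟩, x)) (⟨n', a', r'⟩, x')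
    rw [diagonal_mul, mul_diagonal] at h1
    have h2 : (b n : ℂ) ≠ b n' := fun hh => hn (hb (Complex.ofReal_injective hh))
    have h3 : M (⟨n, a, r⟩, x) (⟨n', a', r'⟩, x') = 0 := by
      have : ((b n : ℂ) - b n') * M (⟨n, a, r⟩, x) (⟨n', a', r'⟩, x') = 0 := by
        rw [sub_mul, h1]; ring
      exact (mul_eq_zero.1 this).resolve_left (sub_ne_zero.2 h2)
    simp [blockSum, Matrix.blockDiagonal'_apply, hn, h3]

lemma supp_mul_le (U Y : Matrix k k ℂ) : supp (U * Y) ≤ supp U := by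
  rintro _ ⟨v, rfl⟩
  exact ⟨Y *ᵥ v, by simp [Matrix.mulVec_mulVec]⟩

/-- The blocks are the eigenspaces of `[T ρ/T σ]` in the support of `T σ`, with one-dimensional
left factors on which `η^L` is the eigenvalue. -/
theorem hasBlockDecomposition_of_intertwines {T : Matrix h h ℂ →ₗ[ℂ] Matrix k k ℂ}
    {U : Matrix (k × e) h ℂ} {ρ σ : Matrix h h ℂ} (hU : Uᴴ * U = 1)
    (hT : ∀ X, T X = ∑ x, krausOp U x * X * (krausOp U x)ᴴ) (hρ : ρ.PosSemidef)
    (hσ : σ.PosSemidef) (hPρ : suppProj σ * ρ = ρ)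
    (H : KrausIntertwines T (krausOp U) ρ σ) : HasBlockDecomposition U (T σ) ρ σ := by
  have hX : (quot ρ σ).PosSemidef := posSemidef_quot hρ
  have hB : (quot (T ρ) (T σ)).PosSemidef := posSemidef_quot (posSemidef_map hT hρ)
  have hPB : suppProj (T σ) * quot (T ρ) (T σ) = quot (T ρ) (T σ) := suppProj_mul_quot _ _
  have hBP := mul_eq_of_conjTranspose (isHermitian_suppProj _) hB.1 hPB
  obtain ⟨N, dR, b, S, hb, hb0, hS1, hS2, hSB⟩ := exists_blockIndex_diagonalization
    (isHermitian_suppProj (T σ)) (suppProj_mul_suppProj (T σ)) hB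
  have hA := posSemidef_map hT hσ
  set A := T σ with hAdef
  set X := quot ρ σ with hXdef
  set B := quot (T ρ) A with hBdef
  have hXρ : msqrt σ * X * msqrt σ = ρ := msqrt_mul_quot_mul_msqrt hσ hPρ
    (mul_eq_of_conjTranspose (isHermitian_suppProj σ) hρ.1 hPρ)
  set W := tensorId e (minvSqrt A) * U * msqrt σ with hW
  have hWk : ∀ x, krausOp W x = petzKraus (krausOp U) A σ x := fun x => by
    rw [hW, krausOp_mul, krausOp_tensorId_mul, petzKraus]
  clear_value W
  have hWX : W * X = tensorId e B * W := krausOp_ext fun x => by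
    rw [krausOp_mul, krausOp_tensorId_mul, hWk]
    have := congrArg conjTranspose (H x)
    rwa [conjTranspose_mul, conjTranspose_mul, conjTranspose_conjTranspose, hX.1.eq, hB.1.eq]
      at this
  have hUW : tensorId e (msqrt A) * W = U * msqrt σ := krausOp_ext fun x => by
    rw [krausOp_tensorId_mul, hWk, msqrt_mul_petzKraus hT hσ, krausOp_mul]
  have hUW' : Wᴴ * tensorId e (msqrt A) = msqrt σ * Uᴴ := by
    have := congrArg conjTranspose hUW
    rwa [conjTranspose_mul, conjTranspose_mul, conjTranspose_tensorId, (isHermitian_msqrt _).eq,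
      (isHermitian_msqrt _).eq] at this
  have hcomm : tensorId e B * (W * Wᴴ) = W * Wᴴ * tensorId e B := by
    have h1 : tensorId e B * (W * Wᴴ) = W * X * Wᴴ := by rw [hWX, Matrix.mul_assoc]
    have h2 := congrArg conjTranspose h1
    simp only [conjTranspose_mul, conjTranspose_conjTranspose, conjTranspose_tensorId, hX.1.eq,
      hB.1.eq] at h2
    rw [h1, h2, Matrix.mul_assoc]
  set D : Matrix (BlockIndex (fun _ : Fin N => 1) dR) (BlockIndex (fun _ : Fin N => 1) dR) ℂ :=
    diagonal fun p => (b p.1 : ℂ) with hD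
  set M := tensorId e S * (W * Wᴴ) * tensorId e Sᴴ with hMdef
  have hDS : D * S = S * B := by rw [← hSB, Matrix.mul_assoc, hS2, Matrix.mul_assoc, hBP]
  have hSD : Sᴴ * D = B * Sᴴ := by
    rw [← hSB, ← Matrix.mul_assoc, ← Matrix.mul_assoc, hS2, hPB]
  have hDM : tensorId e D * M = M * tensorId e D := by
    calc tensorId e D * M = tensorId e (D * S) * (W * Wᴴ) * tensorId e Sᴴ := by
          rw [← tensorId_mul_tensorId]; simp only [hMdef, Matrix.mul_assoc]
      _ = tensorId e S * (tensorId e B * (W * Wᴴ)) * tensorId e Sᴴ := by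
          rw [hDS, ← tensorId_mul_tensorId]; simp only [Matrix.mul_assoc]
      _ = tensorId e S * (W * Wᴴ) * tensorId e (Sᴴ * D) := by
          rw [hcomm, hSD, ← tensorId_mul_tensorId]; simp only [Matrix.mul_assoc]
      _ = _ := by rw [← tensorId_mul_tensorId]; simp only [hMdef, Matrix.mul_assoc]
  have hM : M.PosSemidef := by
    have := posSemidef_self_mul_conjTranspose (tensorId e S * W)
    rwa [conjTranspose_mul, conjTranspose_tensorId, Matrix.mul_assoc, ← Matrix.mul_assoc W,
      ← Matrix.mul_assoc] at this
  set ηR : ∀ n, Matrix (Fin (dR n) × e) (Fin (dR n) × e) ℂ := fun n =>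
    M.submatrix (fun i => (⟨n, (0, i.1)⟩, i.2)) fun i => (⟨n, (0, i.1)⟩, i.2) with hηR
  have hblock : blockSum (dL := fun _ : Fin N => 1) (fun _ => 1) ηR = M :=
    blockSum_of_commute hb M hDM
  have hσe : U * σ * Uᴴ = tensorId e (msqrt A * Sᴴ) * M * tensorId e (S * msqrt A) := by
    calc U * σ * Uᴴ = (U * msqrt σ) * (msqrt σ * Uᴴ) := by
          nth_rewrite 1 [← msqrt_mul_msqrt hσ]; simp only [Matrix.mul_assoc]
      _ = tensorId e (msqrt A) * (W * Wᴴ) * tensorId e (msqrt A) := by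
          rw [← hUW, ← hUW']; simp only [Matrix.mul_assoc]
      _ = tensorId e (msqrt A * (Sᴴ * S)) * (W * Wᴴ) * tensorId e ((Sᴴ * S) * msqrt A) := by
          rw [hS2, msqrt_mul_suppProj, suppProj_mul_msqrt]
      _ = _ := by simp only [hMdef, ← tensorId_mul_tensorId, Matrix.mul_assoc]
  have hρe : U * ρ * Uᴴ
      = tensorId e (msqrt A * Sᴴ) * (tensorId e D * M) * tensorId e (S * msqrt A) := by
    calc U * ρ * Uᴴ = (U * msqrt σ) * X * (msqrt σ * Uᴴ) := by
          rw [← hXρ]; simp only [Matrix.mul_assoc]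
      _ = tensorId e (msqrt A) * (W * X * Wᴴ) * tensorId e (msqrt A) := by
          rw [← hUW, ← hUW']; simp only [Matrix.mul_assoc]
      _ = tensorId e (msqrt A) * (tensorId e B * (W * Wᴴ)) * tensorId e (msqrt A) := by
          rw [hWX]; simp only [Matrix.mul_assoc]
      _ = tensorId e (msqrt A * B * (Sᴴ * S)) * (W * Wᴴ) * tensorId e ((Sᴴ * S) * msqrt A) := by
          rw [hS2, suppProj_mul_msqrt, Matrix.mul_assoc (msqrt A), hBP, ← tensorId_mul_tensorId]
          simp only [Matrix.mul_assoc]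
      _ = tensorId e (msqrt A * (Sᴴ * D) * S) * (W * Wᴴ) * tensorId e ((Sᴴ * S) * msqrt A) := by
          rw [hSD]; simp only [Matrix.mul_assoc]
      _ = _ := by simp only [hMdef, ← tensorId_mul_tensorId, Matrix.mul_assoc]
  have hηD : blockSum (dL := fun _ : Fin N => 1) (fun n => diagonal fun _ => (b n : ℂ)) ηR
      = tensorId e D * M := by
    rw [blockSum_eq_tensorId_mul, hblock]
    congr 2
    have h1 : ∀ n, (diagonal fun _ : Fin 1 => (b n : ℂ)) ⊗ₖ (1 : Matrix (Fin (dR n)) (Fin (dR n)) ℂ)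
        = diagonal fun _ => (b n : ℂ) := fun n => by
      rw [← diagonal_one, diagonal_kronecker_diagonal]; simp
    simp only [h1]
    exact Matrix.blockDiagonal'_diagonal fun n _ => (b n : ℂ)
  have hE : ∀ Y : Matrix h h ℂ, supp (U * Y * Uᴴ) ≤ supp (U * Uᴴ) := fun Y => by
    have h1 : U * Y * Uᴴ = U * Uᴴ * (U * Y * Uᴴ) := by
      calc U * Y * Uᴴ = U * (Uᴴ * U) * Y * Uᴴ := by rw [hU, Matrix.mul_one]
        _ = _ := by simp only [Matrix.mul_assoc]
    rw [h1]
    exact supp_mul_le _ _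
  have hback : ∀ Y : Matrix h h ℂ, Y = Uᴴ * (U * Y * Uᴴ) * U := fun Y => by
    calc Y = (Uᴴ * U) * Y * (Uᴴ * U) := by rw [hU, Matrix.one_mul, Matrix.mul_one]
      _ = _ := by simp only [Matrix.mul_assoc]
  refine ⟨N, fun _ => 1, dR, S, U * ρ * Uᴴ, U * σ * Uᴴ, fun n => diagonal fun _ => (b n : ℂ), ηR,
    hS1, hS2, hρ.mul_mul_conjTranspose_same U, hσ.mul_mul_conjTranspose_same U, hE ρ, hE σ,
    hback ρ, hback σ, fun n => ?_, fun n => hM.submatrix _, ?_, ?_⟩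
  · exact posSemidef_diagonal_iff.2 fun _ => Complex.zero_le_real.2 (hb0 n)
  · rw [hηD, hρe]
  · rw [hblock, hσe]

end Spectral

end BSEntropy

theorem mainTheorem7 {h k e : Type*} [Fintype h] [DecidableEq h] [Fintype k] [DecidableEq k]
    [Fintype e] [DecidableEq e]
    (T : Matrix h h ℂ →ₗ[ℂ] Matrix k k ℂ)
    (U : Matrix (k × e) h ℂ) (hU : U.conjTranspose * U = 1)
    (hT : ∀ X : Matrix h h ℂ, T X = BSEntropy.trE (U * X * U.conjTranspose))
    (ρ σ : Matrix h h ℂ) (hρ : BSEntropy.IsState ρ) (hσ : BSEntropy.IsState σ)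
    (hρσ : BSEntropy.supp ρ ≤ BSEntropy.supp σ) :
    List.TFAE [
      BSEntropy.bsEntropy ρ σ = BSEntropy.bsEntropy (T ρ) (T σ),
      BSEntropy.petzAdjoint T σ (BSEntropy.quot ρ σ ^ 2)
        = (BSEntropy.petzAdjoint T σ (BSEntropy.quot ρ σ)) ^ 2,
      BSEntropy.HasBlockDecomposition U (T σ) ρ σ,
      ρ = σ * BSEntropy.hsAdjoint T (BSEntropy.minv (T σ) * T ρ)] := by
  have hT' : ∀ X, T X = ∑ x, BSEntropy.krausOp U x * X * (BSEntropy.krausOp U x).conjTranspose :=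
    fun X => by rw [hT, BSEntropy.trE_isometry]
  have hV := BSEntropy.sum_krausOp_conjTranspose_mul hU
  have hPρ := BSEntropy.mul_eq_of_supp_le (BSEntropy.suppProj_mul_self hσ.1) hρσ
  have h1 := BSEntropy.bsEntropy_eq_iff hT' hV hρ.1 hσ.1 hPρ
  have h2 := BSEntropy.petzAdjoint_sq_iff hT' hρ.1 hσ.1 hPρ
  have h4 := BSEntropy.recovery_iff hT' hV hρ.1 hσ.1 hPρ
  tfae_have 1 ↔ 2 := h1.trans h2.symm
  tfae_have 2 → 3 := fun hh =>
    BSEntropy.hasBlockDecomposition_of_intertwines hU hT' hρ.1 hσ.1 hPρ (h2.1 hh)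
  tfae_have 3 → 4 := BSEntropy.recovery_of_hasBlockDecomposition hU hT hρ.1 hσ.1
  tfae_have 4 → 2 := fun hh => h2.2 (h4.1 hh)
  tfae_finish
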